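/- Let univariate meadow terms be the expressions built from at most one variable $x$ and the constants $0,1$ by means of unary minus, addition, multiplication and division. Such a term $t$ is evaluated at $a\in\mathbb{C}$ to a complex number $t(a)$ by substituting $a$ for $x$, where division is made total by the convention $b/0=0$ (the complex meadow). The finite support summation $\sum^*_x t(x)$ is the complex number $\sum_{a\in\mathbb{C},\,t(a)\neq 0} t(a)$ if only finitely many $a\in\mathbb{C}$ satisfy $t(a)\neq 0$, and it is $0$ otherwise. Theorem. It is decidable, given a univariate meadow term $t$, whether or not $\sum^*_x t(x)=1$ holds in the complex meadow. That is, the set of all univariate meadow terms $t$ with $\sum^*_x t(x)=1$ is a computable (recursive) set of terms. -/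

import Mathlib

/-- Terms in (at most) one variable over the divisive meadow signature `0, 1, -, +, *, /`. -/
inductive MeadowTerm : Type where
  | var : MeadowTerm
  | zero : MeadowTerm
  | one : MeadowTerm
  | neg : MeadowTerm → MeadowTerm
  | add : MeadowTerm → MeadowTerm → MeadowTerm
  | mul : MeadowTerm → MeadowTerm → MeadowTerm
  | div : MeadowTerm → MeadowTerm → MeadowTerm

namespace MeadowTerm

/-- The value `t(a)` of a term in a field made into a meadow by `b / 0 = 0`
(which is Mathlib's division on a field). -/
def eval {K : Type*} [Field K] (a : K) : MeadowTerm → K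
  | var => a
  | zero => 0
  | one => 1
  | neg s => -s.eval a
  | add s t => s.eval a + t.eval a
  | mul s t => s.eval a * t.eval a
  | div s t => s.eval a / t.eval a

/-- Finite support summation `∑* x, t(x)` in the meadow `K`: the sum of all `t(a)`, `a ∈ K`, if only
finitely many of these values are nonzero, and `0` otherwise. -/
noncomputable def finiteSupportSum (K : Type*) [Field K] (t : MeadowTerm) : K :=
  ∑ᶠ a : K, t.eval a

/-- An effective numbering of the terms. -/
def toNat : MeadowTerm → ℕ
  | var => 0
  | zero => 1
  | one => 2
  | neg s => 4 * s.toNat + 3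
  | add s t => 4 * Nat.pair s.toNat t.toNat + 4
  | mul s t => 4 * Nat.pair s.toNat t.toNat + 5
  | div s t => 4 * Nat.pair s.toNat t.toNat + 6

/-- The term with a given number. -/
def ofNat : ℕ → MeadowTerm
  | 0 => var
  | 1 => zero
  | 2 => one
  | n + 3 =>
    have h : n / 4 < n + 3 := by omega
    have h1 : (n / 4).unpair.1 < n + 3 := lt_of_le_of_lt (Nat.unpair_left_le _) h
    have h2 : (n / 4).unpair.2 < n + 3 := lt_of_le_of_lt (Nat.unpair_right_le _) h
    match n % 4 with
    | 0 => neg (ofNat (n / 4))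
    | 1 => add (ofNat (n / 4).unpair.1) (ofNat (n / 4).unpair.2)
    | 2 => mul (ofNat (n / 4).unpair.1) (ofNat (n / 4).unpair.2)
    | _ => div (ofNat (n / 4).unpair.1) (ofNat (n / 4).unpair.2)

theorem ofNat_toNat (t : MeadowTerm) : ofNat t.toNat = t := by
  induction t with
  | var => simp [toNat, ofNat]
  | zero => simp [toNat, ofNat]
  | one => simp [toNat, ofNat]
  | neg s hs =>
    rw [toNat, ofNat, show 4 * s.toNat % 4 = 0 by omega, show 4 * s.toNat / 4 = s.toNat by omega]
    simp [hs]
  | add s t hs ht =>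
    rw [toNat, show ∀ m, 4 * m + 4 = (4 * m + 1) + 3 by intro m; omega, ofNat,
      show ∀ m, (4 * m + 1) % 4 = 1 by intro m; omega,
      show ∀ m, (4 * m + 1) / 4 = m by intro m; omega]
    simp [hs, ht]
  | mul s t hs ht =>
    rw [toNat, show ∀ m, 4 * m + 5 = (4 * m + 2) + 3 by intro m; omega, ofNat,
      show ∀ m, (4 * m + 2) % 4 = 2 by intro m; omega,
      show ∀ m, (4 * m + 2) / 4 = m by intro m; omega]
    simp [hs, ht]
  | div s t hs ht =>
    rw [toNat, show ∀ m, 4 * m + 6 = (4 * m + 3) + 3 by intro m; omega, ofNat,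
      show ∀ m, (4 * m + 3) % 4 = 3 by intro m; omega,
      show ∀ m, (4 * m + 3) / 4 = m by intro m; omega]
    simp [hs, ht]

theorem toNat_ofNat (n : ℕ) : (ofNat n).toNat = n := by
  induction n using Nat.strong_induction_on with
  | _ n ih =>
    match n with
    | 0 => simp [toNat, ofNat]
    | 1 => simp [toNat, ofNat]
    | 2 => simp [toNat, ofNat]
    | n + 3 =>
      have h : n / 4 < n + 3 := by omega
      have i0 := ih _ h
      have i1 := ih _ (lt_of_le_of_lt (Nat.unpair_left_le _) h)
      have i2 := ih _ (lt_of_le_of_lt (Nat.unpair_right_le _) h)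
      rw [ofNat]
      have h4 : n % 4 = 0 ∨ n % 4 = 1 ∨ n % 4 = 2 ∨ n % 4 = 3 := by omega
      rcases h4 with h4 | h4 | h4 | h4 <;> rw [h4] <;>
        simp only [toNat, i0, i1, i2, Nat.pair_unpair] <;> omega

/-- Terms are identified with their numbers for the purposes of computability theory; the
associated `Primcodable` structure is the one that Mathlib derives from this bijection. -/
instance instDenumerable : Denumerable MeadowTerm :=
  Denumerable.mk' ⟨toNat, ofNat, ofNat_toNat, toNat_ofNat⟩

end MeadowTerm

/-!
The sum is decided modulo a single large prime.

Generically a term `t` is a fraction `P / Q` of integer polynomials (`MeadowTerm.num`,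
`MeadowTerm.den`), and `t(a) = P(a) / Q(a)` at every point `a` of every field with `Q(a) ≠ 0`. If
`P ≠ 0`, then `t` is nonzero at all but finitely many complex numbers and the sum is `0` by
definition. If `P = 0`, then the support consists of roots of `Q`, and the sum can be computed in
the splitting field `L` of `Q` over `ℚ`.

Let `p` be a prime and reduce modulo a prime of `𝓞 L` above `p`. Reduction commutes with addition
and multiplication, and with the totalized division provided that no nonzero divisor reduces to
zero. The values involved are quotients of algebraic integers whose conjugates are bounded by an
explicit function of `t`; an algebraic integer that reduces to zero has a norm divisible by `p`, so
it is zero if `p` exceeds a bound for its norm. Hence, for `p` above the computable number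
`MeadowTerm.threshold t`, the roots of `Q` in `L` correspond bijectively to its roots in the residue
field, the values of `t` correspond to each other, and the sum is `1` in `L` if and only if it is
`1` in the residue field (`MeadowTerm.sum_roots_eq_one_iff`). If moreover `Q` splits over the prime
field, the latter sum is the sum of `t` over all `x` in `ZMod p`, a finite calculation with natural
numbers. Whether `P = 0` is found out modulo `p` as well, by evaluation at a single integer `N`
beyond all complex roots of `P` and `Q`.

That `Q` splits modulo `p` is checked on a proposed factorization (`MeadowTerm.IsCertificate`).
Suitable primes exist for every `t`, as each integer polynomial splits modulo arbitrarily large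
primes (`Polynomial.exists_prime_gt_splits`), so an unbounded search for a certificate terminates.
The check of a certificate and the verdict are primitive recursive, because evaluation of terms by
primitive recursive operations is (`MeadowTerm.primrec_fold`).
-/

open Polynomial
open scoped NumberField

/-! ### The length of an integer polynomial -/

/-- The length of an integer polynomial: the sum of the absolute values of its coefficients. -/
def Polynomial.length (P : ℤ[X]) : ℕ := P.sum fun _ c => c.natAbs

namespace Polynomial

theorem length_eq_sum_range {P : ℤ[X]} {n : ℕ} (h : P.natDegree < n) :
    P.length = ∑ i ∈ Finset.range n, (P.coeff i).natAbs :=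
  sum_over_range' P (by simp) n h

theorem natAbs_coeff_le_length (P : ℤ[X]) (i : ℕ) : (P.coeff i).natAbs ≤ P.length := by
  by_cases h : i ≤ P.natDegree
  · rw [length_eq_sum_range (Nat.lt_succ_self _)]
    exact Finset.single_le_sum (f := fun i => (P.coeff i).natAbs) (fun _ _ => Nat.zero_le _)
      (Finset.mem_range.2 (by omega))
  · simp [coeff_eq_zero_of_natDegree_lt (not_le.1 h)]

@[simp] theorem length_zero : (0 : ℤ[X]).length = 0 := sum_zero_index _

@[simp] theorem length_one : (1 : ℤ[X]).length = 1 := by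
  rw [length, ← C_1, sum_C_index rfl]
  rfl

@[simp] theorem length_X : (X : ℤ[X]).length = 1 := by
  rw [length, sum_X_index rfl]
  rfl

theorem length_add_le (P Q : ℤ[X]) : (P + Q).length ≤ P.length + Q.length := by
  set n := max (max P.natDegree Q.natDegree) (P + Q).natDegree + 1 with hn
  rw [length_eq_sum_range (n := n) (by omega), length_eq_sum_range (P := P) (n := n) (by omega),
    length_eq_sum_range (P := Q) (n := n) (by omega), ← Finset.sum_add_distrib]
  exact Finset.sum_le_sum fun i _ => by simpa using Int.natAbs_add_le _ _

@[simp] theorem length_neg (P : ℤ[X]) : (-P).length = P.length := by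
  rw [length_eq_sum_range (n := P.natDegree + 1) (by simp),
    length_eq_sum_range (Nat.lt_succ_self P.natDegree)]
  simp

theorem length_sum_le {ι : Type*} (s : Finset ι) (f : ι → ℤ[X]) :
    (∑ i ∈ s, f i).length ≤ ∑ i ∈ s, (f i).length := by
  classical
  induction s using Finset.induction_on with
  | empty => simp
  | insert i s hi ih =>
    rw [Finset.sum_insert hi, Finset.sum_insert hi]
    exact (length_add_le _ _).trans (by omega)

theorem length_monomial_mul (n : ℕ) (c : ℤ) (P : ℤ[X]) :
    (monomial n c * P).length = c.natAbs * P.length := by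
  rw [length_eq_sum_range (n := n + (P.natDegree + 1))
      (lt_of_le_of_lt (natDegree_mul_le.trans (Nat.add_le_add_right (natDegree_monomial_le c) _))
        (by omega)),
    length_eq_sum_range (Nat.lt_succ_self P.natDegree), Finset.sum_range_add, Finset.mul_sum,
    Finset.sum_eq_zero, zero_add]
  · refine Finset.sum_congr rfl fun i _ => ?_
    rw [add_comm n i, coeff_monomial_mul, Int.natAbs_mul]
  · intro i hi
    rw [Finset.mem_range] at hi
    rw [← C_mul_X_pow_eq_monomial, mul_assoc, coeff_C_mul, coeff_X_pow_mul', if_neg (by omega)]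
    simp

theorem length_mul_le (P Q : ℤ[X]) : (P * Q).length ≤ P.length * Q.length := by
  conv_lhs => rw [P.as_sum_range, Finset.sum_mul]
  refine (length_sum_le _ _).trans ?_
  rw [length_eq_sum_range (Nat.lt_succ_self P.natDegree), Finset.sum_mul]
  exact Finset.sum_le_sum fun i _ => (length_monomial_mul _ _ _).le

/-- A complex root of a nonzero integer polynomial is smaller than the length plus one, by Cauchy's
bound: the leading coefficient has absolute value at least one. -/
theorem norm_lt_length_add_one {P : ℤ[X]} (hP : P ≠ 0) {z : ℂ} (hz : aeval z P = 0) :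
    ‖z‖ < P.length + 1 := by
  set R := P.map (Int.castRingHom ℂ)
  have inj : Function.Injective (Int.castRingHom ℂ) := Int.cast_injective
  have hR : R ≠ 0 := (Polynomial.map_ne_zero_iff inj).2 hP
  have h1 : R.IsRoot z := by
    rw [IsRoot, eval_map, ← hz]; rfl
  have h2 := h1.norm_lt_cauchyBound hR
  have h3 : cauchyBound R ≤ (P.length : NNReal) + 1 := by
    unfold cauchyBound
    gcongr
    have h4 : (1 : NNReal) ≤ ‖R.leadingCoeff‖₊ := by
      rw [leadingCoeff_map_of_injective inj, ← NNReal.coe_le_coe]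
      simpa [Int.norm_eq_abs] using mod_cast Int.one_le_abs (leadingCoeff_ne_zero.2 hP)
    refine div_le_of_le_mul₀ (by positivity) (by positivity) ?_
    refine le_trans ?_ (le_mul_of_one_le_right (by positivity) h4)
    refine Finset.sup_le fun i _ => ?_
    rw [coeff_map, ← NNReal.coe_le_coe]
    have := natAbs_coeff_le_length P i
    have h5 : ((P.coeff i).natAbs : ℝ) ≤ P.length := mod_cast this
    simpa [Nat.cast_natAbs, Int.norm_eq_abs] using h5
  exact (NNReal.coe_lt_coe.2 (h2.trans_le h3)).trans_eq (by simp)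

theorem natAbs_eval_natCast_le (P : ℤ[X]) {N d : ℕ} (hN : 1 ≤ N) (hd : P.natDegree ≤ d) :
    (P.eval (N : ℤ)).natAbs ≤ P.length * N ^ d := by
  rw [eval_eq_sum_range, length_eq_sum_range (Nat.lt_succ_self P.natDegree), Finset.sum_mul]
  refine (Int.natAbs_sum_le _ _).trans (Finset.sum_le_sum fun i hi => ?_)
  rw [Int.natAbs_mul, Int.natAbs_pow, Int.natAbs_natCast]
  rw [Finset.mem_range] at hi
  gcongr
  omega

/-- A nonzero integer polynomial does not vanish modulo `p` at a point `N` beyond its complex roots,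
once `p` exceeds the value at `N`. -/
theorem aeval_natCast_zmod_ne_zero {P : ℤ[X]} (hP : P ≠ 0) {p N d : ℕ} (hN : P.length + 1 ≤ N)
    (hd : P.natDegree ≤ d) (hp : P.length * N ^ d < p) : aeval (N : ZMod p) P ≠ 0 := by
  have h0 : P.eval (N : ℤ) ≠ 0 := by
    intro h
    have := norm_lt_length_add_one (z := (N : ℂ)) hP (by
      have := congrArg (Int.cast : ℤ → ℂ) h
      rw [Int.cast_zero] at this
      rw [← this, aeval_def, ← eval_map, ← Int.cast_natCast (R := ℂ) N, algebraMap_int_eq,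
        ← eq_intCast (Int.castRingHom ℂ), eval_map_apply]
      rfl)
    rw [Complex.norm_natCast] at this
    have h' : N < P.length + 1 := mod_cast this
    omega
  have h1 : aeval (N : ZMod p) P = ((P.eval (N : ℤ) : ℤ) : ZMod p) := by
    rw [aeval_def, ← eval_map, ← Int.cast_natCast (R := ZMod p) N, algebraMap_int_eq,
        ← eq_intCast (Int.castRingHom (ZMod p)), eval_map_apply]
    rfl
  rw [h1, Ne, ZMod.intCast_zmod_eq_zero_iff_dvd]
  intro h
  have h2 := Nat.le_of_dvd (Int.natAbs_pos.2 h0) (Int.natCast_dvd.1 h)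
  exact (h2.trans (natAbs_eval_natCast_le P (by omega) hd)).not_gt hp

end Polynomial

/-! ### Terms as fractions of polynomials -/

namespace MeadowTerm

open Classical in
/-- A fraction of integer polynomials, as a pair of numerator and denominator, that represents
the term at every point, of every field, where the denominator does not vanish. It is not reduced:
the denominator is made to vanish wherever the denominator of a subterm does. In the case of a
quotient this accounts for the factor `t.numDen.2`. -/
noncomputable def numDen : MeadowTerm → ℤ[X] × ℤ[X]
  | var => (X, 1)
  | zero => (0, 1)
  | one => (1, 1)
  | neg s => (-s.numDen.1, s.numDen.2)
  | add s t => (s.numDen.1 * t.numDen.2 + t.numDen.1 * s.numDen.2, s.numDen.2 * t.numDen.2)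
  | mul s t => (s.numDen.1 * t.numDen.1, s.numDen.2 * t.numDen.2)
  | div s t =>
    if t.numDen.1 = 0 then (0, s.numDen.2 * t.numDen.2)
    else (s.numDen.1 * t.numDen.2 ^ 2, s.numDen.2 * t.numDen.2 * t.numDen.1)

/-- The numerator of the fraction that represents a term. -/
noncomputable abbrev num (t : MeadowTerm) : ℤ[X] := t.numDen.1

/-- The denominator of the fraction that represents a term. -/
noncomputable abbrev den (t : MeadowTerm) : ℤ[X] := t.numDen.2

theorem den_ne_zero (t : MeadowTerm) : t.den ≠ 0 := by
  induction t with
  | var => simp [den, numDen]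
  | zero => simp [den, numDen]
  | one => simp [den, numDen]
  | neg s hs => simpa [den, numDen] using hs
  | add s t hs ht => exact mul_ne_zero hs ht
  | mul s t hs ht => exact mul_ne_zero hs ht
  | div s t hs ht =>
    unfold den numDen
    split_ifs with h
    · exact mul_ne_zero hs ht
    · exact mul_ne_zero (mul_ne_zero hs ht) h

theorem eval_mul_den {K : Type*} [Field K] (a : K) (t : MeadowTerm) (h : aeval a t.den ≠ 0) :
    t.eval a * aeval a t.den = aeval a t.num := by
  induction t with
  | var => simp [den, num, numDen, eval]
  | zero => simp [den, num, numDen, eval]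
  | one => simp [den, num, numDen, eval]
  | neg s hs => simpa [den, num, numDen, eval] using hs h
  | add s t hs ht =>
    simp only [den, num, numDen, eval, map_add, map_mul] at h hs ht ⊢
    rw [← hs (left_ne_zero_of_mul h), ← ht (right_ne_zero_of_mul h)]
    ring
  | mul s t hs ht =>
    simp only [den, num, numDen, eval, map_mul] at h hs ht ⊢
    rw [← hs (left_ne_zero_of_mul h), ← ht (right_ne_zero_of_mul h)]
    ring
  | div s t hs ht =>
    by_cases h0 : t.num = 0
    · have e : (div s t).numDen = (0, s.den * t.den) := if_pos h0
      simp only [den, num, e, map_mul, map_zero] at h hs ht h0 ⊢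
      have h1 := ht (right_ne_zero_of_mul h)
      rw [h0, map_zero] at h1
      simp [eval, (mul_eq_zero.1 h1).resolve_right (right_ne_zero_of_mul h)]
    · have e : (div s t).numDen = (s.num * t.den ^ 2, s.den * t.den * t.num) := if_neg h0
      simp only [den, num, e, map_mul, map_pow] at h hs ht h0 ⊢
      have h2 := right_ne_zero_of_mul (left_ne_zero_of_mul h)
      have h3 := right_ne_zero_of_mul h
      rw [← ht h2] at h3 ⊢
      rw [← hs (left_ne_zero_of_mul (left_ne_zero_of_mul h))]
      have h4 := left_ne_zero_of_mul h3
      simp only [eval]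
      field_simp

theorem eval_map {K F : Type*} [Field K] [Field F] (f : K →+* F) (a : K) (t : MeadowTerm) :
    t.eval (f a) = f (t.eval a) := by
  induction t <;> simp_all [eval]

/-- Evaluation of a term by given operations in an arbitrary type. -/
def fold {β : Type*} (v z o : β) (n : β → β) (a m d : β → β → β) : MeadowTerm → β
  | var => v
  | zero => z
  | one => o
  | neg s => n (s.fold v z o n a m d)
  | add s t => a (s.fold v z o n a m d) (t.fold v z o n a m d)
  | mul s t => m (s.fold v z o n a m d) (t.fold v z o n a m d)
  | div s t => d (s.fold v z o n a m d) (t.fold v z o n a m d)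

/-- A common bound for the degrees and lengths of the numerator and the denominator of a term. -/
def size : MeadowTerm → ℕ :=
  fold 1 1 1 id (fun m n => 3 * m * n ^ 2) (fun m n => 3 * m * n ^ 2) (fun m n => 3 * m * n ^ 2)

theorem one_le_size (t : MeadowTerm) : 1 ≤ t.size := by
  induction t with
  | var | zero | one => exact le_rfl
  | neg s hs => exact hs
  | add s t hs ht | mul s t hs ht | div s t hs ht =>
    change 0 < 3 * s.size * t.size ^ 2
    positivity

theorem natDegree_num_den_le_size (t : MeadowTerm) :
    t.num.natDegree ≤ t.size ∧ t.den.natDegree ≤ t.size := by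
  have key : ∀ s t : MeadowTerm, s.size + 2 * t.size ≤ 3 * s.size * t.size ^ 2 := by
    intro s t
    have hs := one_le_size s
    have ht := one_le_size t
    nlinarith [Nat.mul_le_mul hs ht, Nat.mul_le_mul hs (Nat.mul_le_mul ht ht),
      Nat.mul_le_mul (Nat.le_refl t.size) hs,
      Nat.mul_le_mul (Nat.le_refl s.size) (Nat.mul_le_mul ht ht),
      Nat.mul_le_mul hs (Nat.mul_le_mul (Nat.le_refl t.size) ht)]
  induction t with
  | var => simp [den, num, numDen, size, fold]
  | zero => simp [den, num, numDen, size, fold]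
  | one => simp [den, num, numDen, size, fold]
  | neg s hs => simpa [den, num, numDen, size, fold] using hs
  | add s t hs ht =>
    have hk := key s t
    simp only [num, den] at hs ht
    refine ⟨(natDegree_add_le _ _).trans (max_le ?_ ?_), ?_⟩ <;>
    · refine natDegree_mul_le.trans (le_trans ?_ hk)
      omega
  | mul s t hs ht =>
    have hk := key s t
    simp only [num, den] at hs ht
    refine ⟨?_, ?_⟩ <;>
    · refine natDegree_mul_le.trans (le_trans ?_ hk)
      omega
  | div s t hs ht =>
    have hk := key s t
    change s.size + 2 * t.size ≤ (div s t).size at hk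
    simp only [num, den] at hs ht
    unfold num den numDen
    split_ifs
    · refine ⟨by simp, natDegree_mul_le.trans (le_trans ?_ hk)⟩
      omega
    · have h2 : (t.numDen.2 ^ 2).natDegree ≤ _ := natDegree_pow_le
      have h3 : (s.numDen.2 * t.numDen.2).natDegree ≤ _ := natDegree_mul_le
      refine ⟨natDegree_mul_le.trans (le_trans ?_ hk), natDegree_mul_le.trans (le_trans ?_ hk)⟩ <;>
      omega

theorem length_num_den_le_size (t : MeadowTerm) :
    t.num.length ≤ t.size ∧ t.den.length ≤ t.size := by
  induction t with
  | var | zero | one => simp [den, num, numDen, size, fold]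
  | neg s hs => simpa [den, num, numDen, size, fold] using hs
  | add s t hs ht =>
    change _ ≤ 3 * s.size * t.size ^ 2 ∧ _ ≤ 3 * s.size * t.size ^ 2
    have h1 := one_le_size t
    have h2 : s.size * t.size ≤ s.size * t.size ^ 2 := by gcongr; nlinarith
    constructor
    · refine (length_add_le _ _).trans ?_
      have h3 := (length_mul_le s.num t.den).trans (Nat.mul_le_mul hs.1 ht.2)
      have h4 := (length_mul_le t.num s.den).trans (Nat.mul_le_mul ht.1 hs.2)
      nlinarith
    · have h3 := (length_mul_le s.den t.den).trans (Nat.mul_le_mul hs.2 ht.2)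
      exact h3.trans (by nlinarith)
  | mul s t hs ht =>
    change _ ≤ 3 * s.size * t.size ^ 2 ∧ _ ≤ 3 * s.size * t.size ^ 2
    have h1 := one_le_size t
    have h2 : s.size * t.size ≤ s.size * t.size ^ 2 := by gcongr; nlinarith
    have h3 := (length_mul_le s.den t.den).trans (Nat.mul_le_mul hs.2 ht.2)
    have h4 := (length_mul_le s.num t.num).trans (Nat.mul_le_mul hs.1 ht.1)
    exact ⟨h4.trans (by nlinarith), h3.trans (by nlinarith)⟩
  | div s t hs ht =>
    change _ ≤ 3 * s.size * t.size ^ 2 ∧ _ ≤ 3 * s.size * t.size ^ 2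
    have h1 := one_le_size t
    have h2 : s.size * t.size ≤ s.size * t.size ^ 2 := by gcongr; nlinarith
    have h3 := (length_mul_le s.den t.den).trans (Nat.mul_le_mul hs.2 ht.2)
    unfold num den numDen
    split_ifs
    · exact ⟨by simp, h3.trans (by nlinarith)⟩
    · have h4 := (length_mul_le (s.den * t.den) t.num).trans (Nat.mul_le_mul h3 ht.1)
      have h5 := (length_mul_le t.den t.den).trans (Nat.mul_le_mul ht.2 ht.2)
      have h6 := (length_mul_le s.num (t.den * t.den)).trans (Nat.mul_le_mul hs.1 h5)
      rw [← pow_two] at h6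
      exact ⟨h6.trans (by nlinarith), h4.trans (by nlinarith)⟩

end MeadowTerm

/-! ### Primitive recursion on terms -/

namespace MeadowTerm

/-- Evaluation of a term by primitive recursive operations, which may depend on a parameter, is
primitive recursive: this is a course-of-values recursion on the number of the term. -/
theorem primrec_fold {α β : Type*} [Primcodable α] [Primcodable β] {v z o : α → β}
    {n : α → β → β} {a m d : α → β → β → β} (hv : Primrec v) (hz : Primrec z) (ho : Primrec o)
    (hn : Primrec₂ n) (ha : Primrec fun q : α × β × β => a q.1 q.2.1 q.2.2)
    (hm : Primrec fun q : α × β × β => m q.1 q.2.1 q.2.2)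
    (hd : Primrec fun q : α × β × β => d q.1 q.2.1 q.2.2) :
    Primrec₂ fun x (t : MeadowTerm) => t.fold (v x) (z x) (o x) (n x) (a x) (m x) (d x) := by
  have look : ∀ {i : α × List β → ℕ}, Primrec i →
      Primrec fun q : α × List β => (q.2[i q]?).getD (v q.1) := fun hi =>
    Primrec.option_getD.comp (Primrec.list_getElem?.comp Primrec.snd hi) (hv.comp Primrec.fst)
  have hlen : Primrec fun q : α × List β => q.2.length := Primrec.list_length.comp Primrec.snd
  have hk : Primrec fun q : α × List β => q.2.length - 3 :=
    Primrec.nat_sub.comp hlen (Primrec.const 3)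
  have hi : Primrec fun q : α × List β => (q.2.length - 3) / 4 :=
    Primrec.nat_div.comp hk (Primrec.const 4)
  have hr : Primrec fun q : α × List β => (q.2.length - 3) % 4 :=
    Primrec.nat_mod.comp hk (Primrec.const 4)
  have h1 : Primrec fun q : α × List β => ((q.2.length - 3) / 4).unpair.1 :=
    Primrec.fst.comp (Primrec.unpair.comp hi)
  have h2 : Primrec fun q : α × List β => ((q.2.length - 3) / 4).unpair.2 :=
    Primrec.snd.comp (Primrec.unpair.comp hi)
  have bin : ∀ {f : α → β → β → β}, (Primrec fun q : α × β × β => f q.1 q.2.1 q.2.2) →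
      Primrec fun q : α × List β => f q.1
        ((q.2[((q.2.length - 3) / 4).unpair.1]?).getD (v q.1))
        ((q.2[((q.2.length - 3) / 4).unpair.2]?).getD (v q.1)) := fun hf =>
    hf.comp (Primrec.fst.pair ((look h1).pair (look h2)))
  have hc : ∀ {f : α × List β → ℕ}, Primrec f → ∀ k, PrimrecPred fun q => f q = k :=
    fun hf k => Primrec.eq.comp hf (Primrec.const k)
  -- The list `l` holds the values of the terms with numbers below `l.length`.
  have hg : Primrec₂ fun (x : α) (l : List β) => some (
      if l.length = 0 then v x else if l.length = 1 then z x else if l.length = 2 then o x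
      else if (l.length - 3) % 4 = 0 then n x ((l[(l.length - 3) / 4]?).getD (v x))
      else if (l.length - 3) % 4 = 1 then a x ((l[((l.length - 3) / 4).unpair.1]?).getD (v x))
        ((l[((l.length - 3) / 4).unpair.2]?).getD (v x))
      else if (l.length - 3) % 4 = 2 then m x ((l[((l.length - 3) / 4).unpair.1]?).getD (v x))
        ((l[((l.length - 3) / 4).unpair.2]?).getD (v x))
      else d x ((l[((l.length - 3) / 4).unpair.1]?).getD (v x))
        ((l[((l.length - 3) / 4).unpair.2]?).getD (v x))) :=
    Primrec.option_some.comp <|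
      Primrec.ite (hc hlen 0) (hv.comp Primrec.fst) <|
      Primrec.ite (hc hlen 1) (hz.comp Primrec.fst) <|
      Primrec.ite (hc hlen 2) (ho.comp Primrec.fst) <|
      Primrec.ite (hc hr 0) (hn.comp Primrec.fst (look hi)) <|
      Primrec.ite (hc hr 1) (bin ha) <| Primrec.ite (hc hr 2) (bin hm) (bin hd)
  have key := Primrec.nat_strong_rec
    (fun x k => (ofNat k).fold (v x) (z x) (o x) (n x) (a x) (m x) (d x)) hg (by
      intro x k
      have hget : ∀ {i : ℕ} {f : ℕ → β}, i < k → ((List.range k).map f)[i]? = some (f i) := by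
        intro i f hik
        simp [hik]
      simp only [List.length_map, List.length_range, Option.some.injEq]
      match k with
      | 0 => simp [ofNat, fold]
      | 1 => simp [ofNat, fold]
      | 2 => simp [ofNat, fold]
      | k + 3 =>
        have h : k / 4 < k + 3 := by omega
        have e1 := Nat.unpair_left_le (k / 4)
        have e2 := Nat.unpair_right_le (k / 4)
        rw [Nat.add_sub_cancel, hget (by omega), hget (by omega), hget (by omega), ofNat]
        have h4 : k % 4 = 0 ∨ k % 4 = 1 ∨ k % 4 = 2 ∨ k % 4 = 3 := by omega
        rcases h4 with h4 | h4 | h4 | h4 <;> rw [h4] <;> simp [fold])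
  refine (key.comp Primrec.fst (Primrec.encode.comp Primrec.snd)).of_eq fun q => ?_
  change (ofNat q.2.toNat).fold _ _ _ _ _ _ _ = _
  rw [ofNat_toNat]

theorem _root_.Primrec.nat_pow : Primrec₂ fun m n : ℕ => m ^ n :=
  Primrec₂.unpaired'.1 Nat.Primrec.pow

theorem _root_.Primrec.nat_prime : PrimrecPred Nat.Prime := by
  have hdvd : PrimrecRel fun m n : ℕ => ¬(2 ≤ m ∧ n % m = 0) :=
    ((Primrec.nat_le.comp (Primrec.const 2) Primrec.fst).and
      (Primrec.eq.comp (Primrec.nat_mod.comp Primrec.snd Primrec.fst) (Primrec.const 0))).not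
  refine ((Primrec.nat_le.comp (Primrec.const 2) Primrec.id).and
    (hdvd.forall_lt.comp Primrec.id Primrec.id)).of_eq fun p => ?_
  rw [Nat.prime_def_lt']
  refine and_congr Iff.rfl ⟨fun h m h2 hm hd => h m hm ⟨h2, Nat.mod_eq_zero_of_dvd hd⟩,
    fun h m hm ⟨h2, hd⟩ => h m h2 hm (Nat.dvd_of_mod_eq_zero hd)⟩

/-! ### Certificates and the decision procedure -/

/-- A bound for the numerators and denominators of the values of a term at a point that is a
quotient of algebraic integers bounded by `B`; see `IsReduction`. -/
def height (B : ℕ) : MeadowTerm → ℕ :=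
  fold B B B id (fun m n => 2 * m * n) (fun m n => 2 * m * n) (fun m n => 2 * m * n)

/-- The primes above this number are large enough for reduction modulo them to preserve all that
matters about a term. Its first summand bounds the absolute norms of the algebraic integers that
must remain nonzero, its second one the value of the numerator and the denominator of the term at
`t.size + 1`. -/
def threshold (t : MeadowTerm) : ℕ :=
  ((2 * t.height (t.size * (t.size + 1))) ^ t.size * 2) ^ t.size ^ t.size
    + t.size * (t.size + 1) ^ t.size + 2

/-- Representatives, modulo a prime `p`, of the values of a term at `x` and at `N` and of the value
of its denominator at `x`. The value at `N` serves to find out whether the numerator of a divisor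
is the zero polynomial. Inverses modulo `p` are powers with exponent `p - 2`, which gives `0⁻¹ = 0`
for `p > 2`. -/
def modEval (p N x : ℕ) : MeadowTerm → ℕ × ℕ × ℕ :=
  fold (x, N, 1) (0, 0, 1) (1, 1, 1) (fun s => ((p - 1) * s.1, (p - 1) * s.2.1, s.2.2))
    (fun s t => (s.1 + t.1, s.2.1 + t.2.1, s.2.2 * t.2.2))
    (fun s t => (s.1 * t.1, s.2.1 * t.2.1, s.2.2 * t.2.2))
    (fun s t => (s.1 * t.1 ^ (p - 2), s.2.1 * t.2.1 ^ (p - 2),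
      s.2.2 * t.2.2 * if t.2.1 % p = 0 then 1 else t.1 * t.2.2))

/-- A certificate for a term: a prime `p` above the threshold, and a factorization of the
denominator of the term into linear factors modulo `p`. It is stated as the equality of the values
at all residues, which suffices as the degrees are less than `p`. -/
def IsCertificate (t : MeadowTerm) (c : ℕ × ℕ × List ℕ) : Prop :=
  c.1.Prime ∧ t.threshold < c.1 ∧ c.2.2.length < c.1 ∧
    ∀ x < c.1, (modEval c.1 (t.size + 1) x t).2.2 % c.1 =
      (c.2.1 * (c.2.2.map (x + ·)).prod) % c.1

/-- The verdict modulo a prime `p`: the term vanishes generically, and its values at the residues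
modulo `p` sum up to `1`. -/
def Verdict (t : MeadowTerm) (p : ℕ) : Prop :=
  (modEval p (t.size + 1) 0 t).2.1 % p = 0 ∧
    (∑ x ∈ Finset.range p, (modEval p (t.size + 1) x t).1) % p = 1

theorem primrec_size : Primrec size := by
  have h : Primrec fun q : Unit × ℕ × ℕ => 3 * q.2.1 * q.2.2 ^ 2 :=
    Primrec.nat_mul.comp
      (Primrec.nat_mul.comp (Primrec.const 3) (Primrec.fst.comp Primrec.snd))
      (Primrec.nat_pow.comp (Primrec.snd.comp Primrec.snd) (Primrec.const 2))
  exact (primrec_fold (α := Unit) (n := fun _ => id) (a := fun _ m n => 3 * m * n ^ 2)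
    (m := fun _ m n => 3 * m * n ^ 2) (d := fun _ m n => 3 * m * n ^ 2) (Primrec.const 1)
    (Primrec.const 1) (Primrec.const 1)
    Primrec₂.right h h h).comp (Primrec.const ()) Primrec.id

theorem primrec_height : Primrec₂ height := by
  have h : Primrec fun q : ℕ × ℕ × ℕ => 2 * q.2.1 * q.2.2 :=
    Primrec.nat_mul.comp
      (Primrec.nat_mul.comp (Primrec.const 2) (Primrec.fst.comp Primrec.snd))
      (Primrec.snd.comp Primrec.snd)
  exact primrec_fold (α := ℕ) (n := fun _ => id) (a := fun _ m n => 2 * m * n)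
    (m := fun _ m n => 2 * m * n) (d := fun _ m n => 2 * m * n) Primrec.id Primrec.id
    Primrec.id Primrec₂.right h h h

theorem primrec_threshold : Primrec threshold := by
  have hs := primrec_size
  have hs1 : Primrec fun t : MeadowTerm => t.size + 1 := Primrec.succ.comp hs
  have hh : Primrec fun t : MeadowTerm => t.height (t.size * (t.size + 1)) :=
    primrec_height.comp (Primrec.nat_mul.comp hs hs1) Primrec.id
  exact Primrec.nat_add.comp (Primrec.nat_add.comp
    (Primrec.nat_pow.comp
      (Primrec.nat_mul.comp
        (Primrec.nat_pow.comp (Primrec.nat_mul.comp (Primrec.const 2) hh) hs) (Primrec.const 2))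
      (Primrec.nat_pow.comp hs hs))
    (Primrec.nat_mul.comp hs (Primrec.nat_pow.comp hs1 hs))) (Primrec.const 2)

theorem primrec_modEval :
    Primrec fun q : (ℕ × ℕ × ℕ) × MeadowTerm => modEval q.1.1 q.1.2.1 q.1.2.2 q.2 := by
  have s1 {α β : Type} [Primcodable α] [Primcodable β] :
      Primrec fun q : α × (ℕ × ℕ × ℕ) × β => q.2.1.1 :=
    Primrec.fst.comp (Primrec.fst.comp Primrec.snd)
  have s2 {α β : Type} [Primcodable α] [Primcodable β] :
      Primrec fun q : α × (ℕ × ℕ × ℕ) × β => q.2.1.2.1 :=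
    Primrec.fst.comp (Primrec.snd.comp (Primrec.fst.comp Primrec.snd))
  have s3 {α β : Type} [Primcodable α] [Primcodable β] :
      Primrec fun q : α × (ℕ × ℕ × ℕ) × β => q.2.1.2.2 :=
    Primrec.snd.comp (Primrec.snd.comp (Primrec.fst.comp Primrec.snd))
  have t1 {α β : Type} [Primcodable α] [Primcodable β] :
      Primrec fun q : α × β × (ℕ × ℕ × ℕ) => q.2.2.1 :=
    Primrec.fst.comp (Primrec.snd.comp Primrec.snd)
  have t2 {α β : Type} [Primcodable α] [Primcodable β] :
      Primrec fun q : α × β × (ℕ × ℕ × ℕ) => q.2.2.2.1 :=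
    Primrec.fst.comp (Primrec.snd.comp (Primrec.snd.comp Primrec.snd))
  have t3 {α β : Type} [Primcodable α] [Primcodable β] :
      Primrec fun q : α × β × (ℕ × ℕ × ℕ) => q.2.2.2.2 :=
    Primrec.snd.comp (Primrec.snd.comp (Primrec.snd.comp Primrec.snd))
  have p2 : Primrec fun q : (ℕ × ℕ × ℕ) × (ℕ × ℕ × ℕ) × (ℕ × ℕ × ℕ) => q.1.1 - 2 :=
    Primrec.nat_sub.comp (Primrec.fst.comp Primrec.fst) (Primrec.const 2)
  have p1 : Primrec fun q : (ℕ × ℕ × ℕ) × (ℕ × ℕ × ℕ) => q.1.1 - 1 :=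
    Primrec.nat_sub.comp (Primrec.fst.comp Primrec.fst) (Primrec.const 1)
  refine primrec_fold (α := ℕ × ℕ × ℕ) (β := ℕ × ℕ × ℕ) (v := fun q => (q.2.2, q.2.1, 1))
    (z := fun _ => (0, 0, 1)) (o := fun _ => (1, 1, 1))
    (n := fun q s => ((q.1 - 1) * s.1, (q.1 - 1) * s.2.1, s.2.2))
    (a := fun _ s t => (s.1 + t.1, s.2.1 + t.2.1, s.2.2 * t.2.2))
    (m := fun _ s t => (s.1 * t.1, s.2.1 * t.2.1, s.2.2 * t.2.2))
    (d := fun q s t => (s.1 * t.1 ^ (q.1 - 2), s.2.1 * t.2.1 ^ (q.1 - 2),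
      s.2.2 * t.2.2 * if t.2.1 % q.1 = 0 then 1 else t.1 * t.2.2)) ?_ (Primrec.const _)
    (Primrec.const _) ?_ ?_ ?_ ?_
  · exact (Primrec.snd.comp Primrec.snd).pair
      ((Primrec.fst.comp Primrec.snd).pair (Primrec.const 1))
  · exact (Primrec.nat_mul.comp p1 (Primrec.fst.comp Primrec.snd)).pair
      ((Primrec.nat_mul.comp p1 (Primrec.fst.comp (Primrec.snd.comp Primrec.snd))).pair
        (Primrec.snd.comp (Primrec.snd.comp Primrec.snd)))
  · exact (Primrec.nat_add.comp s1 t1).pair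
      ((Primrec.nat_add.comp s2 t2).pair (Primrec.nat_mul.comp s3 t3))
  · exact (Primrec.nat_mul.comp s1 t1).pair
      ((Primrec.nat_mul.comp s2 t2).pair (Primrec.nat_mul.comp s3 t3))
  · exact (Primrec.nat_mul.comp s1 (Primrec.nat_pow.comp t1 p2)).pair
      ((Primrec.nat_mul.comp s2 (Primrec.nat_pow.comp t2 p2)).pair
        (Primrec.nat_mul.comp (Primrec.nat_mul.comp s3 t3) (Primrec.ite
          (Primrec.eq.comp (Primrec.nat_mod.comp t2 (Primrec.fst.comp Primrec.fst))
            (Primrec.const 0)) (Primrec.const 1) (Primrec.nat_mul.comp t1 t3))))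

theorem primrec_prod_map_add : Primrec₂ fun (l : List ℕ) (x : ℕ) => (l.map (x + ·)).prod :=
  Primrec.list_foldr (f := fun q : List ℕ × ℕ => q.1.map (q.2 + ·)) (g := fun _ => 1)
    (h := fun _ b => b.1 * b.2) (Primrec.list_map Primrec.fst
      (Primrec.nat_add.comp (Primrec.snd.comp Primrec.fst) Primrec.snd)) (Primrec.const 1)
    (Primrec.nat_mul.comp (Primrec.fst.comp Primrec.snd) (Primrec.snd.comp Primrec.snd))

theorem primrecRel_den_eq_prod :
    PrimrecRel fun (x : ℕ) (q : MeadowTerm × ℕ × ℕ × List ℕ) =>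
      (modEval q.2.1 (q.1.size + 1) x q.1).2.2 % q.2.1 =
        (q.2.2.1 * (q.2.2.2.map (x + ·)).prod) % q.2.1 := by
  have h1 : Primrec fun r : ℕ × MeadowTerm × ℕ × ℕ × List ℕ => r.2.2.1 :=
    Primrec.fst.comp (Primrec.snd.comp Primrec.snd)
  have hl : Primrec fun r : ℕ × MeadowTerm × ℕ × ℕ × List ℕ => r.2.2.2.2 :=
    Primrec.snd.comp (Primrec.snd.comp (Primrec.snd.comp Primrec.snd))
  have hden : Primrec fun r : ℕ × MeadowTerm × ℕ × ℕ × List ℕ =>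
      (modEval r.2.2.1 (r.2.1.size + 1) r.1 r.2.1).2.2 :=
    Primrec.snd.comp (Primrec.snd.comp (primrec_modEval.comp
      ((h1.pair ((Primrec.succ.comp
        (primrec_size.comp (Primrec.fst.comp Primrec.snd))).pair Primrec.fst)).pair
        (Primrec.fst.comp Primrec.snd))))
  have hfac : Primrec fun r : ℕ × MeadowTerm × ℕ × ℕ × List ℕ =>
      r.2.2.2.1 * (r.2.2.2.2.map (r.1 + ·)).prod :=
    Primrec.nat_mul.comp (Primrec.fst.comp (Primrec.snd.comp (Primrec.snd.comp Primrec.snd)))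
      (primrec_prod_map_add.comp hl Primrec.fst)
  exact Primrec.eq.comp (Primrec.nat_mod.comp hden h1) (Primrec.nat_mod.comp hfac h1)

theorem primrecPred_isCertificate :
    PrimrecPred fun q : MeadowTerm × ℕ × ℕ × List ℕ => IsCertificate q.1 q.2 := by
  have hp : Primrec fun q : MeadowTerm × ℕ × ℕ × List ℕ => q.2.1 := Primrec.fst.comp Primrec.snd
  have hl : Primrec fun q : MeadowTerm × ℕ × ℕ × List ℕ => q.2.2.2 :=
    Primrec.snd.comp (Primrec.snd.comp Primrec.snd)
  have hall : PrimrecPred fun q : MeadowTerm × ℕ × ℕ × List ℕ => ∀ x < q.2.1,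
      (modEval q.2.1 (q.1.size + 1) x q.1).2.2 % q.2.1 =
        (q.2.2.1 * (q.2.2.2.map (x + ·)).prod) % q.2.1 :=
    (primrecRel_den_eq_prod.forall_mem_list.comp (Primrec.list_range.comp hp)
      Primrec.id).of_eq fun q => by simp only [List.mem_range, id]
  exact (Primrec.nat_prime.comp hp).and ((Primrec.nat_lt.comp
    (primrec_threshold.comp Primrec.fst) hp).and ((Primrec.nat_lt.comp
      (Primrec.list_length.comp hl) hp).and hall))

theorem primrecRel_verdict : PrimrecRel Verdict := by
  have hev : ∀ {α : Type} [Primcodable α] {f : α → ℕ} {g : α → MeadowTerm} {x : α → ℕ},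
      Primrec f → Primrec g → Primrec x →
        Primrec fun a => modEval (f a) ((g a).size + 1) (x a) (g a) := fun hf hg hx =>
    primrec_modEval.comp ((hf.pair ((Primrec.succ.comp (primrec_size.comp hg)).pair hx)).pair hg)
  have hsum : Primrec fun q : MeadowTerm × ℕ =>
      ∑ x ∈ Finset.range q.2, (modEval q.2 (q.1.size + 1) x q.1).1 := by
    refine (Primrec.nat_rec' (f := fun q : MeadowTerm × ℕ => q.2) (g := fun _ => 0)
      (h := fun q b => b.2 + (modEval q.2 (q.1.size + 1) b.1 q.1).1) Primrec.snd
      (Primrec.const 0) ?_).of_eq fun q => ?_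
    · exact Primrec.nat_add.comp (Primrec.snd.comp Primrec.snd) (Primrec.fst.comp
        (hev (Primrec.snd.comp Primrec.fst) (Primrec.fst.comp Primrec.fst)
          (Primrec.fst.comp Primrec.snd)))
    · have : ∀ n, (Nat.rec 0 (fun y IH => IH + (modEval q.2 (q.1.size + 1) y q.1).1) n : ℕ) =
          ∑ x ∈ Finset.range n, (modEval q.2 (q.1.size + 1) x q.1).1 := by
        intro n
        induction n with
        | zero => rfl
        | succ n ih => rw [Finset.sum_range_succ, ← ih]
      exact this q.2
  exact (Primrec.eq.comp (Primrec.nat_mod.comp (Primrec.fst.comp (Primrec.snd.comp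
    (hev Primrec.snd Primrec.fst (Primrec.const 0)))) Primrec.snd) (Primrec.const 0)).and
    (Primrec.eq.comp (Primrec.nat_mod.comp hsum Primrec.snd) (Primrec.const 1))

/-- Search for certificates decides a predicate on terms if every term has a certificate and each
certificate provides the right verdict. -/
theorem computablePred_of_certificates (S : MeadowTerm → Prop)
    (hex : ∀ t, ∃ c, IsCertificate t c) (hS : ∀ t c, IsCertificate t c → (S t ↔ Verdict t c.1)) :
    ComputablePred S := by
  classical
  let g : MeadowTerm → ℕ → Option Bool := fun t n =>
    if IsCertificate t (Denumerable.ofNat (ℕ × ℕ × List ℕ) n) then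
      some (decide (Verdict t (Denumerable.ofNat (ℕ × ℕ × List ℕ) n).1)) else none
  have hc : Primrec fun q : MeadowTerm × ℕ => Denumerable.ofNat (ℕ × ℕ × List ℕ) q.2 :=
    (Primrec.ofNat _).comp Primrec.snd
  have hg : Primrec₂ g :=
    Primrec.ite (primrecPred_isCertificate.comp (Primrec.fst.pair hc))
      (Primrec.option_some.comp
        (PrimrecPred.decide (primrecRel_verdict.comp Primrec.fst (Primrec.fst.comp hc))))
      (Primrec.const none)
  refine ⟨fun _ => Classical.propDecidable _, ?_⟩
  refine (Partrec.rfindOpt hg.to_comp).of_eq fun t => ?_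
  have hdom : (Nat.rfindOpt (g t)).Dom := by
    obtain ⟨c, hc⟩ := hex t
    refine Nat.rfindOpt_dom.2 ⟨Encodable.encode c, decide (Verdict t c.1), ?_⟩
    simp only [g, Denumerable.ofNat_encode, if_pos hc, Option.mem_def]
  obtain ⟨b, hb⟩ := Part.dom_iff_mem.1 hdom
  obtain ⟨n, hn⟩ := Nat.rfindOpt_spec hb
  rw [Part.eq_some_iff.2 hb]
  simp only [g, Option.mem_def] at hn
  split_ifs at hn with h
  rw [← Option.some.inj hn]
  simp only [PFun.coe_val, Part.some_inj]
  exact decide_eq_decide.2 (hS t _ h).symm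

end MeadowTerm

/-! ### Correctness of the calculations modulo a prime -/

namespace MeadowTerm

theorem natCast_modEval_fst {p : ℕ} [hp : Fact p.Prime] (h2 : 2 < p) (N x : ℕ) (t : MeadowTerm) :
    ((modEval p N x t).1 : ZMod p) = t.eval (x : ZMod p) ∧
      ((modEval p N x t).2.1 : ZMod p) = t.eval (N : ZMod p) := by
  have hneg : ((p - 1 : ℕ) : ZMod p) = -1 := by
    rw [Nat.cast_sub hp.out.one_le]
    simp
  have hinv : ∀ y : ZMod p, y ^ (p - 2) = y⁻¹ := by
    intro y
    by_cases hy : y = 0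
    · rw [hy, inv_zero, zero_pow (by omega)]
    · refine eq_inv_of_mul_eq_one_left ?_
      rw [← pow_succ, show p - 2 + 1 = p - 1 by omega, ZMod.pow_card_sub_one_eq_one hy]
  induction t with
  | var => simp [modEval, fold, eval]
  | zero => simp [modEval, fold, eval]
  | one => simp [modEval, fold, eval]
  | neg s hs => simp_all [modEval, fold, eval]
  | add s t hs ht => simp_all [modEval, fold, eval]
  | mul s t hs ht => simp_all [modEval, fold, eval]
  | div s t hs ht => simp_all [modEval, fold, eval, div_eq_mul_inv]

theorem aeval_natCast_den_ne_zero {p N : ℕ} {t : MeadowTerm} (hN : t.size + 1 ≤ N)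
    (hpN : t.size * N ^ t.size < p) : aeval (N : ZMod p) t.den ≠ 0 :=
  aeval_natCast_zmod_ne_zero (den_ne_zero t)
    ((Nat.add_le_add_right (length_num_den_le_size t).2 1).trans hN)
    (natDegree_num_den_le_size t).2
    ((Nat.mul_le_mul_right _ (length_num_den_le_size t).2).trans_lt hpN)

theorem eval_natCast_eq_zero_iff {p N : ℕ} [Fact p.Prime] {t : MeadowTerm}
    (hN : t.size + 1 ≤ N) (hpN : t.size * N ^ t.size < p) :
    t.eval (N : ZMod p) = 0 ↔ t.num = 0 := by
  have h := aeval_natCast_den_ne_zero hN hpN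
  have h1 := eval_mul_den (N : ZMod p) t h
  constructor
  · intro h0
    rw [h0, zero_mul] at h1
    by_contra hne
    exact aeval_natCast_zmod_ne_zero hne
      ((Nat.add_le_add_right (length_num_den_le_size t).1 1).trans hN)
      (natDegree_num_den_le_size t).1
      ((Nat.mul_le_mul_right _ (length_num_den_le_size t).1).trans_lt hpN) h1.symm
  · intro h0
    rw [h0, map_zero] at h1
    exact (mul_eq_zero.1 h1).resolve_right h

theorem size_le_binary (s t : MeadowTerm) :
    s.size ≤ 3 * s.size * t.size ^ 2 ∧ t.size ≤ 3 * s.size * t.size ^ 2 := by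
  have hs := one_le_size s
  have ht := one_le_size t
  have h := Nat.mul_le_mul hs ht
  constructor
  · nlinarith [Nat.mul_le_mul (Nat.le_refl s.size) (Nat.mul_le_mul ht ht)]
  · nlinarith [Nat.mul_le_mul hs (Nat.mul_le_mul (Nat.le_refl t.size) ht)]

theorem natCast_modEval_den {p N : ℕ} [hp : Fact p.Prime] (h2 : 2 < p) (x : ℕ) (t : MeadowTerm)
    (hN : t.size + 1 ≤ N) (hpN : t.size * N ^ t.size < p) :
    ((modEval p N x t).2.2 : ZMod p) = aeval (x : ZMod p) t.den := by
  have mono : ∀ {m n : ℕ}, m ≤ n → n * N ^ n < p → m * N ^ m < p := by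
    intro m n hmn h
    refine (Nat.mul_le_mul hmn (Nat.pow_le_pow_right (by omega) hmn)).trans_lt h
  induction t with
  | var => simp [modEval, fold, den, numDen]
  | zero => simp [modEval, fold, den, numDen]
  | one => simp [modEval, fold, den, numDen]
  | neg s hs => exact hs hN hpN
  | add s t hs ht | mul s t hs ht =>
    change 3 * s.size * t.size ^ 2 + 1 ≤ N at hN
    change 3 * s.size * t.size ^ 2 * N ^ (3 * s.size * t.size ^ 2) < p at hpN
    obtain ⟨h3, h4⟩ := size_le_binary s t
    change (((modEval p N x s).2.2 * (modEval p N x t).2.2 : ℕ) : ZMod p) = aeval _ (s.den * t.den)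
    rw [Nat.cast_mul, hs (by omega) (mono h3 hpN), ht (by omega) (mono h4 hpN), map_mul]
  | div s t hs ht =>
    change 3 * s.size * t.size ^ 2 + 1 ≤ N at hN
    change 3 * s.size * t.size ^ 2 * N ^ (3 * s.size * t.size ^ 2) < p at hpN
    obtain ⟨h3, h4⟩ := size_le_binary s t
    have hs' := hs (by omega) (mono h3 hpN)
    have ht' := ht (by omega) (mono h4 hpN)
    have hz := eval_natCast_eq_zero_iff (p := p) (N := N) (t := t) (by omega) (mono h4 hpN)
    rw [← (natCast_modEval_fst h2 N x t).2, ZMod.natCast_eq_zero_iff,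
      Nat.dvd_iff_mod_eq_zero] at hz
    change (((modEval p N x s).2.2 * (modEval p N x t).2.2 * if (modEval p N x t).2.1 % p = 0
      then 1 else (modEval p N x t).1 * (modEval p N x t).2.2 : ℕ) : ZMod p) = _
    by_cases h0 : t.num = 0
    · have e : (div s t).numDen = (0, s.den * t.den) := if_pos h0
      rw [if_pos (hz.2 h0), den, e, mul_one, Nat.cast_mul, hs', ht', map_mul]
    · have e : (div s t).numDen = (s.num * t.den ^ 2, s.den * t.den * t.num) := if_neg h0
      rw [if_neg (mt hz.1 h0), den, e]
      simp only [Nat.cast_mul, map_mul]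
      rw [hs', ht', (natCast_modEval_fst h2 N x t).1]
      by_cases hd : aeval (x : ZMod p) t.den = 0
      · simp [hd]
      · rw [eval_mul_den _ t hd]

end MeadowTerm

/-! ### Reduction of factorizations -/

/-- If the roots of an integer polynomial, multiplied by `e`, lie in a subring `R` of a field in
which the polynomial splits, then the factorization persists under every homomorphism from `R` to
a field that does not kill `e`. -/
theorem Polynomial.aeval_eq_mul_prod_of_roots_lift {R L k : Type*} [CommRing R] [Field L] [Field k]
    [Algebra R L] (hinj : Function.Injective (algebraMap R L)) (φ : R →+* k) {Q : ℤ[X]} [CharZero L]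
    (hL : (Q.map (Int.castRingHom L)).Splits) {e : R} (he : φ e ≠ 0) {s : Multiset R}
    (hs : s.map (algebraMap R L) =
      (Q.map (Int.castRingHom L)).roots.map (algebraMap R L e * ·)) (y : k) :
    aeval y Q = (Q.leadingCoeff : k) * ((s.map fun u => φ u / φ e).map (y - ·)).prod := by
  have h1 : C e ^ Multiset.card s * Q.map (Int.castRingHom R) =
      C (Q.leadingCoeff : R) * (s.map fun u => C e * X - C u).prod := by
    apply map_injective (algebraMap R L) hinj
    rw [Polynomial.map_mul, Polynomial.map_mul, Polynomial.map_pow, map_C, map_C,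
      Polynomial.map_map, Polynomial.map_multiset_prod, Multiset.map_map]
    have e1 : (algebraMap R L).comp (Int.castRingHom R) = Int.castRingHom L := RingHom.ext_int _ _
    have e2 : s.map (Polynomial.map (algebraMap R L) ∘ fun u => C e * X - C u) =
        (s.map (algebraMap R L)).map fun a => C (algebraMap R L e) * X - C a := by
      rw [Multiset.map_map]
      refine Multiset.map_congr rfl fun u _ => ?_
      simp
    have e3 : Multiset.card s = Multiset.card (Q.map (Int.castRingHom L)).roots := by
      rw [← Multiset.card_map (algebraMap R L), hs, Multiset.card_map]
    rw [e1, e2, hs, Multiset.map_map, e3]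
    refine (congrArg (C (algebraMap R L e) ^ _ * ·) hL.eq_prod_roots).trans ?_
    rw [leadingCoeff_map_of_injective Int.cast_injective, mul_left_comm, map_intCast]
    congr 1
    rw [← Multiset.prod_replicate, ← Multiset.map_const', ← Multiset.prod_map_mul]
    refine congrArg _ (Multiset.map_congr rfl fun a _ => ?_)
    simp only [Function.comp, map_mul]
    ring
  have h2 := congrArg (eval₂ φ y) h1
  have e1 : φ.comp (Int.castRingHom R) = Int.castRingHom k := RingHom.ext_int _ _
  rw [eval₂_mul, eval₂_mul, eval₂_pow, eval₂_C, eval₂_C, eval₂_map, e1, eval₂_multiset_prod,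
    Multiset.map_map, map_intCast] at h2
  have e4 : (s.map (eval₂ φ y ∘ fun u => C e * X - C u)) =
      s.map fun u => φ e * (y - φ u / φ e) := by
    refine Multiset.map_congr rfl fun u _ => ?_
    simp only [Function.comp, eval₂_sub, eval₂_mul, eval₂_C, eval₂_X]
    field_simp
  rw [e4, Multiset.prod_map_mul, Multiset.map_const', Multiset.prod_replicate, mul_left_comm] at h2
  rw [Multiset.map_map]
  exact mul_left_cancel₀ (pow_ne_zero _ he) h2

/-! ### Reduction of values in a number field -/

/-- An algebraic integer with conjugates of absolute value at most `H` in a number field of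
degree `n` does not reduce to zero at a prime above `p > H ^ n`, as its norm is less than `p`. -/
theorem NumberField.eq_zero_of_map_eq_zero {L k : Type*} [Field L] [NumberField L] [Field k]
    {p : ℕ} [CharP k p] (φ : 𝓞 L →+* k) {u : 𝓞 L} {H : ℕ}
    (hu : ∀ σ : L →+* ℂ, ‖σ u‖ ≤ H) (hH : H ^ Module.finrank ℚ L < p) (h0 : φ u = 0) : u = 0 := by
  have hle : (Algebra.norm ℤ u).natAbs ≤ H ^ Module.finrank ℚ L := by
    have h1 : ‖algebraMap ℚ ℂ (Algebra.norm ℚ (u : L))‖ ≤ (H : ℝ) ^ Module.finrank ℚ L := by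
      rw [Algebra.norm_eq_prod_embeddings ℚ ℂ, norm_prod, ← AlgHom.card ℚ L ℂ,
        ← Finset.card_univ, ← Finset.prod_const]
      exact Finset.prod_le_prod (fun _ _ => norm_nonneg _) fun σ _ => hu σ.toRingHom
    rw [← Algebra.coe_norm_int] at h1
    have h2 : ‖algebraMap ℚ ℂ ((Algebra.norm ℤ u : ℤ) : ℚ)‖ = ((Algebra.norm ℤ u).natAbs : ℝ) := by
      rw [map_intCast, Complex.norm_intCast, Nat.cast_natAbs, Int.cast_abs]
    rw [h2] at h1
    exact_mod_cast h1
  have hmem := Ideal.absNorm_mem (Ideal.span {u})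
  rw [Ideal.absNorm_span_singleton, Ideal.mem_span_singleton] at hmem
  obtain ⟨v, hv⟩ := hmem
  have hdvd : p ∣ (Algebra.norm ℤ u).natAbs := by
    rw [← CharP.cast_eq_zero_iff k p, ← map_natCast φ, hv, map_mul, h0, zero_mul]
  have hzero := Nat.eq_zero_of_dvd_of_lt hdvd (hle.trans_lt hH)
  rwa [Int.natAbs_eq_zero, Algebra.norm_eq_zero_iff] at hzero

/-- The element `ζ` of the residue field is the reduction of the element `z` of a number field, as
witnessed by a representation of `z` as a quotient of algebraic integers whose conjugates have
absolute values at most `H`. -/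
def IsReduction {L k : Type*} [Field L] [Field k] (φ : 𝓞 L →+* k) (H : ℕ) (z : L) (ζ : k) : Prop :=
  ∃ u w : 𝓞 L, φ w ≠ 0 ∧ algebraMap (𝓞 L) L w * z = algebraMap (𝓞 L) L u ∧ φ w * ζ = φ u ∧
    ∀ σ : L →+* ℂ, ‖σ (algebraMap (𝓞 L) L u)‖ ≤ H ∧ ‖σ (algebraMap (𝓞 L) L w)‖ ≤ H

namespace IsReduction

variable {L k : Type*} [Field L] [Field k] {φ : 𝓞 L →+* k} {H H' : ℕ} {z z' : L} {ζ ζ' : k}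

theorem mono (h : IsReduction φ H z ζ) (hH : H ≤ H') : IsReduction φ H' z ζ := by
  obtain ⟨u, w, h1, h2, h3, h4⟩ := h
  have : (H : ℝ) ≤ H' := mod_cast hH
  exact ⟨u, w, h1, h2, h3, fun σ => ⟨(h4 σ).1.trans this, (h4 σ).2.trans this⟩⟩

theorem zero (hH : 1 ≤ H) : IsReduction φ H 0 0 := by
  have : (1 : ℝ) ≤ H := mod_cast hH
  exact ⟨0, 1, by simp, by simp, by simp, fun σ => by simp [this]⟩

theorem one (hH : 1 ≤ H) : IsReduction φ H 1 1 := by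
  have : (1 : ℝ) ≤ H := mod_cast hH
  exact ⟨1, 1, by simp, by simp, by simp, fun σ => by simp [this]⟩

theorem neg (h : IsReduction φ H z ζ) : IsReduction φ H (-z) (-ζ) := by
  obtain ⟨u, w, h1, h2, h3, h4⟩ := h
  exact ⟨-u, w, h1, by simp [h2], by simp [h3], fun σ => by simpa using h4 σ⟩

theorem add (h : IsReduction φ H z ζ) (h' : IsReduction φ H' z' ζ') :
    IsReduction φ (2 * H * H') (z + z') (ζ + ζ') := by
  obtain ⟨u, w, h1, h2, h3, h4⟩ := h
  obtain ⟨u', w', h1', h2', h3', h4'⟩ := h'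
  refine ⟨u * w' + u' * w, w * w', by simp [h1, h1'], ?_, ?_, fun σ => ?_⟩
  · simp only [map_add, map_mul]
    rw [← h2, ← h2']
    ring
  · simp only [map_add, map_mul]
    rw [← h3, ← h3']
    ring
  · have b1 := mul_le_mul (h4 σ).1 (h4' σ).2 (norm_nonneg _) (Nat.cast_nonneg _)
    have b2 := mul_le_mul (h4' σ).1 (h4 σ).2 (norm_nonneg _) (Nat.cast_nonneg _)
    have b3 := mul_le_mul (h4 σ).2 (h4' σ).2 (norm_nonneg _) (Nat.cast_nonneg _)
    have b4 : (0 : ℝ) ≤ H * H' := by positivity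
    push_cast
    simp only [map_add, map_mul]
    constructor
    · refine (norm_add_le _ _).trans ?_
      rw [norm_mul, norm_mul]
      linarith
    · rw [norm_mul]
      linarith

theorem mul (h : IsReduction φ H z ζ) (h' : IsReduction φ H' z' ζ') :
    IsReduction φ (2 * H * H') (z * z') (ζ * ζ') := by
  obtain ⟨u, w, h1, h2, h3, h4⟩ := h
  obtain ⟨u', w', h1', h2', h3', h4'⟩ := h'
  refine ⟨u * u', w * w', by simp [h1, h1'], ?_, ?_, fun σ => ?_⟩
  · simp only [map_mul]
    rw [← h2, ← h2']
    ring
  · simp only [map_mul]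
    rw [← h3, ← h3']
    ring
  · have b1 := mul_le_mul (h4 σ).1 (h4' σ).1 (norm_nonneg _) (Nat.cast_nonneg _)
    have b3 := mul_le_mul (h4 σ).2 (h4' σ).2 (norm_nonneg _) (Nat.cast_nonneg _)
    have b4 : (0 : ℝ) ≤ H * H' := by positivity
    push_cast
    simp only [map_mul, norm_mul]
    constructor <;> linarith

theorem inv (h : IsReduction φ H z ζ) (h0 : ζ ≠ 0) : IsReduction φ H z⁻¹ ζ⁻¹ := by
  obtain ⟨u, w, h1, h2, h3, h4⟩ := h
  have h5 : φ u ≠ 0 := by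
    rw [← h3]
    exact mul_ne_zero h1 h0
  have h6 : z ≠ 0 := by
    rintro rfl
    rw [mul_zero] at h2
    exact h5 (by rw [NumberField.RingOfIntegers.coe_eq_zero_iff.1 h2.symm, map_zero])
  refine ⟨w, u, h5, ?_, ?_, fun σ => (h4 σ).symm⟩
  · rw [← h2, mul_inv_cancel_right₀ h6]
  · rw [← h3, mul_inv_cancel_right₀ h0]

theorem sum {ι : Type*} (s : Finset ι) {f : ι → L} {g : ι → k}
    (h : ∀ i ∈ s, IsReduction φ H (f i) (g i)) :
    IsReduction φ ((2 * H) ^ s.card) (∑ i ∈ s, f i) (∑ i ∈ s, g i) := by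
  classical
  induction s using Finset.induction_on with
  | empty => simpa using zero le_rfl
  | insert i s hi ih =>
    rw [Finset.sum_insert hi, Finset.sum_insert hi, Finset.card_insert_of_notMem hi, pow_succ']
    exact (h i (Finset.mem_insert_self _ _)).add
      (ih fun j hj => h j (Finset.mem_insert_of_mem hj))

theorem eq_zero_iff [NumberField L] {p : ℕ} [CharP k p] (h : IsReduction φ H z ζ)
    (hH : H ^ Module.finrank ℚ L < p) : z = 0 ↔ ζ = 0 := by
  obtain ⟨u, w, h1, h2, h3, h4⟩ := h
  have hw : algebraMap (𝓞 L) L w ≠ 0 := by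
    intro hw
    exact h1 (by rw [NumberField.RingOfIntegers.coe_eq_zero_iff.1 hw, map_zero])
  constructor
  · rintro rfl
    rw [mul_zero] at h2
    rw [NumberField.RingOfIntegers.coe_eq_zero_iff.1 h2.symm, map_zero] at h3
    exact (mul_eq_zero.1 h3).resolve_left h1
  · rintro rfl
    rw [mul_zero] at h3
    have hu := NumberField.eq_zero_of_map_eq_zero φ (fun σ => (h4 σ).1) hH h3.symm
    rw [hu, map_zero] at h2
    exact (mul_eq_zero.1 h2).resolve_left hw

end IsReduction

namespace MeadowTerm

theorem le_height {B : ℕ} (hB : 1 ≤ B) (t : MeadowTerm) : B ≤ t.height B := by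
  induction t with
  | var | zero | one => exact le_rfl
  | neg s hs => exact hs
  | add s t hs ht | mul s t hs ht | div s t hs ht =>
    change B ≤ 2 * s.height B * t.height B
    nlinarith

theorem height_le_binary {B : ℕ} (hB : 1 ≤ B) (s t : MeadowTerm) :
    s.height B ≤ 2 * s.height B * t.height B ∧ t.height B ≤ 2 * s.height B * t.height B := by
  have hs := hB.trans (le_height hB s)
  have ht := hB.trans (le_height hB t)
  constructor <;> nlinarith

/-- Reduction modulo a large prime commutes with the evaluation of terms: a nonzero divisor does not
become zero. -/
theorem isReduction_eval {L k : Type*} [Field L] [NumberField L] [Field k] {φ : 𝓞 L →+* k}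
    {p : ℕ} [CharP k p] {B : ℕ} (hB : 1 ≤ B) {a : L} {α : k} (ha : IsReduction φ B a α)
    (t : MeadowTerm) (hp : t.height B ^ Module.finrank ℚ L < p) :
    IsReduction φ (t.height B) (t.eval a) (t.eval α) := by
  have mono : ∀ {m n : ℕ}, m ≤ n → n ^ Module.finrank ℚ L < p → m ^ Module.finrank ℚ L < p :=
    fun h h' => (Nat.pow_le_pow_left h _).trans_lt h'
  induction t with
  | var => exact ha
  | zero => exact .zero hB
  | one => exact .one hB
  | neg s hs => exact (hs hp).neg
  | add s t hs ht =>
    have h := height_le_binary hB s t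
    exact (hs (mono h.1 hp)).add (ht (mono h.2 hp))
  | mul s t hs ht =>
    have h := height_le_binary hB s t
    exact (hs (mono h.1 hp)).mul (ht (mono h.2 hp))
  | div s t hs ht =>
    have h := height_le_binary hB s t
    have hs' := hs (mono h.1 hp)
    have ht' := ht (mono h.2 hp)
    change IsReduction φ (2 * s.height B * t.height B) (s.eval a / t.eval a) (s.eval α / t.eval α)
    by_cases h0 : t.eval α = 0
    · rw [h0, (ht'.eq_zero_iff (mono h.2 hp)).2 h0, div_zero, div_zero]
      have hs := hB.trans (le_height hB s)
      have ht := hB.trans (le_height hB t)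
      exact .zero (by nlinarith)
    · rw [div_eq_mul_inv, div_eq_mul_inv]
      exact hs'.mul (ht'.inv h0)

/-- What is needed of a prime above the threshold. The number `n` stands for the degree of the
splitting field; the last three facts do not involve it. -/
theorem threshold_spec {t : MeadowTerm} {p n : ℕ} (hp : t.threshold < p)
    (hn : n ≤ t.size ^ t.size) :
    ((2 * t.height (t.size * (t.size + 1))) ^ t.size * 2) ^ n < p ∧
      t.size * (t.size + 1) ^ t.size < p ∧ t.size < p ∧ 2 < p := by
  have hs := one_le_size t
  unfold threshold at hp
  have h1 : 1 ≤ (2 * t.height (t.size * (t.size + 1))) ^ t.size * 2 := by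
    have := (show 1 ≤ t.size * (t.size + 1) by nlinarith).trans
      (le_height (show 1 ≤ t.size * (t.size + 1) by nlinarith) t)
    have h2 : 0 < (2 * t.height (t.size * (t.size + 1))) ^ t.size := by positivity
    omega
  have h2 := Nat.pow_le_pow_right h1 hn
  have h3 : t.size ≤ t.size * (t.size + 1) ^ t.size := Nat.le_mul_of_pos_right _ (by positivity)
  refine ⟨?_, ?_, ?_, ?_⟩ <;> omega

/-! ### Comparison of the sums -/

open Classical in
/-- Over a splitting field of the denominator, a term that vanishes generically is supported at the
roots of the denominator. These roots correspond to the roots modulo a large prime. -/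
theorem sum_roots_eq_one_iff {L k : Type*} [Field L] [NumberField L] [Field k]
    (φ : 𝓞 L →+* k) {p : ℕ} [Fact p.Prime] [CharP k p] {t : MeadowTerm} (hp : t.threshold < p)
    (hfin : Module.finrank ℚ L ≤ t.size ^ t.size) (hnum : t.num = 0)
    (hL : (t.den.map (Int.castRingHom L)).Splits)
    (hk : ∀ y : k, aeval y t.den = 0 → ∃ x : ZMod p, ZMod.castHom dvd_rfl k x = y) :
    ∑ a ∈ (t.den.map (Int.castRingHom L)).roots.toFinset, t.eval a = 1 ↔
      ∑ x : ZMod p, t.eval x = 1 := by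
  obtain ⟨hM, -, hsp, -⟩ := threshold_spec hp hfin
  have hs := one_le_size t
  set B := t.size * (t.size + 1) with hBdef
  have hB : 2 ≤ B := by nlinarith
  have hBh := le_height (by omega : 1 ≤ B) t
  set h := t.height B with hh
  set M := (2 * h) ^ t.size * 2 with hMdef
  have hpow : 2 * h ≤ (2 * h) ^ t.size := Nat.le_self_pow (by omega) _
  have mono : ∀ {m : ℕ}, m ≤ M → m ^ Module.finrank ℚ L < p :=
    fun h => (Nat.pow_le_pow_left h _).trans_lt hM
  set d := t.den.leadingCoeff with hd
  have hd0 : d ≠ 0 := leadingCoeff_ne_zero.2 (den_ne_zero t)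
  have hds : d.natAbs ≤ t.size :=
    (natAbs_coeff_le_length _ _).trans (length_num_den_le_size t).2
  have hdk : (d : k) ≠ 0 := by
    rw [Ne, CharP.intCast_eq_zero_iff k p, Int.natCast_dvd]
    intro h
    have := Nat.le_of_dvd (Int.natAbs_pos.2 hd0) h
    omega
  set Z := (t.den.map (Int.castRingHom L)).roots with hZ
  have hroot : ∀ a ∈ Z, aeval a t.den = 0 := by
    intro a ha
    have := isRoot_of_mem_roots ha
    rwa [IsRoot, Polynomial.eval_map] at this
  have hex : ∀ a : L, ∃ u : 𝓞 L, a ∈ Z → algebraMap (𝓞 L) L u = d * a := by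
    intro a
    by_cases ha : a ∈ Z
    · have hi := isIntegral_leadingCoeff_smul t.den a (hroot a ha)
      exact ⟨⟨_, hi⟩, fun _ => by simp [hd]⟩
    · exact ⟨0, fun h => absurd h ha⟩
  choose U hU using hex
  -- The correspondence of roots: `d * a` is an algebraic integer for every root `a`.
  set r : L → k := fun a => φ (U a) / φ (d : 𝓞 L) with hr
  have hφd : φ (d : 𝓞 L) = d := map_intCast φ d
  have hfac : ∀ y : k, aeval y t.den = (d : k) * ((Z.map r).map (y - ·)).prod := by
    intro y
    have := aeval_eq_mul_prod_of_roots_lift (R := 𝓞 L) (L := L)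
      NumberField.RingOfIntegers.coe_injective φ hL (e := (d : 𝓞 L)) (by rwa [hφd])
      (s := Z.map U) (by
        rw [Multiset.map_map]
        refine Multiset.map_congr rfl fun a ha => ?_
        rw [map_intCast]
        exact hU a ha) y
    rw [this, Multiset.map_map (g := fun u => φ u / φ (d : 𝓞 L))]
    rfl
  have hzero : ∀ y : k, aeval y t.den = 0 ↔ ∃ a ∈ Z, r a = y := by
    intro y
    rw [hfac y, mul_eq_zero, or_iff_right hdk, Multiset.prod_eq_zero_iff]
    simp [sub_eq_zero, eq_comm (a := y)]
  have hred : ∀ a ∈ Z, IsReduction φ B a (r a) := by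
    intro a ha
    refine ⟨U a, d, by rwa [hφd], by rw [hU a ha]; simp, mul_div_cancel₀ _ (by rwa [hφd]),
      fun σ => ?_⟩
    have h1 : ‖σ (algebraMap (𝓞 L) L d)‖ = d.natAbs := by
      simp [Nat.cast_natAbs]
    have h2 : ‖σ a‖ ≤ t.size + 1 := by
      have h3 : aeval (σ a) t.den = 0 := by
        have := congrArg σ (hroot a ha)
        rwa [map_zero, aeval_def, hom_eval₂, RingHom.ext_int (σ.comp _) (algebraMap ℤ ℂ)] at this
      have h4 := norm_lt_length_add_one (den_ne_zero t) h3
      have h5 : (t.den.length : ℝ) ≤ t.size := mod_cast (length_num_den_le_size t).2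
      linarith
    have h3 : (d.natAbs : ℝ) ≤ t.size := mod_cast hds
    have h4 : (B : ℝ) = t.size * (t.size + 1) := by simp [hBdef]
    constructor
    · have h5 : ‖σ (algebraMap (𝓞 L) L (U a))‖ = d.natAbs * ‖σ a‖ := by
        rw [hU a ha, map_mul, norm_mul, ← h1]
        simp
      rw [h5, h4]
      gcongr
    · rw [h1, h4]
      nlinarith [Nat.cast_nonneg (α := ℝ) t.size]
  -- Differences of roots do not reduce to zero either.
  have hinj : Set.InjOn r Z.toFinset := by
    intro a ha b hb hab
    have ha' := hred a (by simpa using ha)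
    have hb' := hred b (by simpa using hb)
    have h1 := ha'.add hb'.neg
    rw [hab, add_neg_cancel] at h1
    refine sub_eq_zero.1 ((sub_eq_add_neg a b).trans ((h1.eq_zero_iff (mono ?_)).2 rfl))
    -- For a term of size one, `B = 2`, and the factor `2` of `M` is needed.
    rcases hs.eq_or_lt with h1 | h1
    · have hB2 : B = 2 := by rw [hBdef, ← h1]
      have : h * 4 ≤ M := by omega
      rw [hB2] at hBh ⊢
      omega
    · have h2 : (2 * h) ^ 2 ≤ (2 * h) ^ t.size := Nat.pow_le_pow_right (by omega) h1
      nlinarith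
  have hcard : Z.toFinset.card ≤ t.size :=
    (Multiset.toFinset_card_le _).trans ((card_roots' _).trans (natDegree_map_le.trans
      (natDegree_num_den_le_size t).2))
  have hsum := IsReduction.sum Z.toFinset (f := fun a => t.eval a) (g := fun a => t.eval (r a))
    fun a ha => isReduction_eval (p := p) (by omega) (hred a (by simpa using ha)) t
      (mono (by omega))
  have hsub := (hsum.mono (Nat.pow_le_pow_right (by omega : 1 ≤ 2 * h) hcard)).add
    (IsReduction.one le_rfl).neg
  -- The sum over the roots, minus one, is itself a bounded quotient of algebraic integers.
  have key := hsub.eq_zero_iff (mono (by rw [hMdef]; linarith))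
  rw [← sub_eq_add_neg, ← sub_eq_add_neg, sub_eq_zero, sub_eq_zero] at key
  rw [key]
  set ι : ZMod p →+* k := ZMod.castHom dvd_rfl k with hι
  have hmod : ∑ a ∈ Z.toFinset, t.eval (r a) = ι (∑ x : ZMod p, t.eval x) := by
    rw [map_sum, ← Finset.sum_image (f := fun y => t.eval y) hinj]
    have e1 : ∑ x : ZMod p, ι (t.eval x) = ∑ y ∈ Finset.univ.image ι, t.eval y := by
      rw [Finset.sum_image ι.injective.injOn]
      exact Finset.sum_congr rfl fun x _ => (eval_map ι x t).symm
    rw [e1]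
    refine Finset.sum_subset ?_ fun y _ hy => ?_
    · intro y hy
      obtain ⟨a, ha, rfl⟩ := Finset.mem_image.1 hy
      obtain ⟨x, hx⟩ := hk (r a) ((hzero _).2 ⟨a, by simpa using ha, rfl⟩)
      exact Finset.mem_image.2 ⟨x, Finset.mem_univ _, hx⟩
    · have hne : aeval y t.den ≠ 0 := by
        intro h0
        obtain ⟨a, ha, hay⟩ := (hzero y).1 h0
        exact hy (Finset.mem_image.2 ⟨a, by simpa using ha, hay⟩)
      have := eval_mul_den y t hne
      rw [hnum, map_zero] at this
      exact (mul_eq_zero.1 this).resolve_right hne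
  rw [hmod, ← map_one ι, ι.injective.eq_iff]

end MeadowTerm

/-! ### Primes modulo which a polynomial splits -/

/-- The values of a nonconstant integer polynomial have arbitrarily large prime divisors: if
`c = f(0)`, then `f(c * B! * k) / c` is congruent to `1` modulo `B!`. -/
theorem Polynomial.exists_prime_gt_dvd_eval {f : ℤ[X]} (hf : 0 < f.natDegree) (B : ℕ) :
    ∃ p : ℕ, p.Prime ∧ B < p ∧ ∃ n : ℤ, (p : ℤ) ∣ f.eval n := by
  obtain ⟨q, hqB, hq⟩ := Nat.exists_infinite_primes (B + 1)
  set c := f.eval 0 with hc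
  by_cases hc0 : c = 0
  · exact ⟨q, hq, hqB, 0, by rw [← hc, hc0]; exact dvd_zero _⟩
  have hB : (B.factorial : ℤ) ≠ 0 := mod_cast B.factorial_ne_zero
  obtain ⟨g, hg⟩ : X ∣ f - C c := by
    rw [X_dvd_iff, coeff_sub, coeff_C_zero, hc, coeff_zero_eq_eval_zero, sub_self]
  have hfx : ∀ x : ℤ, f.eval x = c + x * g.eval x := by
    intro x
    have := congrArg (Polynomial.eval x) hg
    rw [eval_sub, eval_C, eval_mul, eval_X] at this
    linarith
  obtain ⟨k, hk⟩ : ∃ k : ℕ, ((f - C c) * (f + C c)).eval (c * B.factorial * k) ≠ 0 := by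
    by_contra! hall
    have hinj : Function.Injective fun k : ℕ => c * B.factorial * (k : ℤ) := by
      intro k l hkl
      exact_mod_cast mul_left_cancel₀ (mul_ne_zero hc0 hB) hkl
    have hzero := eq_zero_of_infinite_isRoot _ (Set.infinite_of_injective_forall_mem hinj hall)
    rcases mul_eq_zero.1 hzero with h | h
    · rw [sub_eq_zero.1 h, natDegree_C] at hf
      exact hf.false
    · rw [eq_neg_of_add_eq_zero_left h, ← C_neg, natDegree_C] at hf
      exact hf.false
  set x := c * B.factorial * (k : ℤ) with hx
  set y := 1 + B.factorial * (k * g.eval x) with hy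
  have hfy : f.eval x = c * y := by
    rw [hfx, hy, hx]
    ring
  by_cases hy0 : y = 0
  · exact ⟨q, hq, hqB, x, by rw [hfy, hy0, mul_zero]; exact dvd_zero _⟩
  have hy1 : y.natAbs ≠ 1 := by
    intro h
    rw [eval_mul, eval_sub, eval_add, eval_C, hfy] at hk
    rcases Int.natAbs_eq_iff.1 h with h | h <;> rw [h] at hk <;> simp at hk
  obtain ⟨p, hp, hpy⟩ := Nat.exists_prime_and_dvd hy1
  have hpy' : (p : ℤ) ∣ y := Int.natCast_dvd.2 hpy
  refine ⟨p, hp, ?_, x, hfy ▸ hpy'.mul_left c⟩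
  by_contra hle
  have h1 : (p : ℤ) ∣ B.factorial := mod_cast (hp.dvd_factorial).2 (not_lt.1 hle)
  have h2 : (p : ℤ) ∣ 1 := (dvd_add_left (h1.mul_right (k * g.eval x))).1 (hy ▸ hpy')
  exact hp.one_lt.ne' (by exact_mod_cast Int.eq_one_of_dvd_one (by positivity) h2)

/-- Every integer polynomial splits modulo arbitrarily large primes `p`: a number field
over which it splits is generated by some integral `θ`, and it suffices that the minimal polynomial
of `θ` has a root modulo `p` and that `p` does not divide the denominators of the roots as
polynomials in `θ`. -/
theorem Polynomial.exists_prime_gt_splits (L : Type*) [Field L] [NumberField L] {Q : ℤ[X]}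
    (hL : (Q.map (Int.castRingHom L)).Splits) (B : ℕ) :
    ∃ p : ℕ, p.Prime ∧ B < p ∧ ∃ s : Multiset (ZMod p), Multiset.card s ≤ Q.natDegree ∧
      ∀ y : ZMod p, aeval y Q = (Q.leadingCoeff : ZMod p) * (s.map (y - ·)).prod := by
  obtain ⟨θ₀, hθ₀⟩ := Field.exists_primitive_element ℚ L
  obtain ⟨m, hm, hθ⟩ := ((IsFractionRing.isAlgebraic_iff ℤ ℚ L).2
    (Algebra.IsAlgebraic.isAlgebraic θ₀) : IsAlgebraic ℤ θ₀).exists_integral_multiple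
  set θ := m • θ₀ with hθdef
  have htop : Algebra.adjoin ℚ {θ} = ⊤ := by
    have h0 : Algebra.adjoin ℚ {θ₀} = ⊤ := by
      rw [← IntermediateField.adjoin_simple_toSubalgebra_of_isAlgebraic
        (Algebra.IsAlgebraic.isAlgebraic θ₀), hθ₀, IntermediateField.top_toSubalgebra]
    rw [eq_top_iff, ← h0]
    refine Algebra.adjoin_le (Set.singleton_subset_iff.2 ?_)
    have h1 := (Algebra.adjoin ℚ {θ}).smul_mem (Algebra.self_mem_adjoin_singleton ℚ θ) (m : ℚ)⁻¹
    have h2 : (m : ℚ)⁻¹ • θ = θ₀ := by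
      rw [hθdef, ← Int.cast_smul_eq_zsmul ℚ m θ₀, inv_smul_smul₀ (mod_cast hm)]
    rwa [h2] at h1
  set A := Algebra.adjoin ℤ {θ} with hA
  have hden : ∀ a : L, ∃ D : ℤ, D ≠ 0 ∧ (D : L) * a ∈ A := by
    intro a
    have ha : a ∈ Algebra.adjoin ℚ {θ} := htop ▸ Algebra.mem_top
    induction ha using Algebra.adjoin_induction with
    | mem x hx =>
      rw [Set.mem_singleton_iff.1 hx]
      exact ⟨1, one_ne_zero, by
        rw [Int.cast_one, one_mul]
        exact Algebra.self_mem_adjoin_singleton ℤ θ⟩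
    | algebraMap q =>
      refine ⟨q.den, mod_cast q.den_ne_zero, ?_⟩
      have : ((q.den : ℤ) : L) * algebraMap ℚ L q = algebraMap ℤ L q.num := by
        rw [← map_intCast (algebraMap ℚ L), ← map_mul, Int.cast_natCast, Rat.den_mul_eq_num]
        simp
      rw [this]
      exact A.algebraMap_mem _
    | add x y _ _ hx hy =>
      obtain ⟨D, hD, h1⟩ := hx
      obtain ⟨E, hE, h2⟩ := hy
      refine ⟨D * E, mul_ne_zero hD hE, ?_⟩
      have : ((D * E : ℤ) : L) * (x + y) = E * (D * x) + D * (E * y) := by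
        push_cast
        ring
      rw [this]
      exact A.add_mem (A.mul_mem (A.intCast_mem E) h1) (A.mul_mem (A.intCast_mem D) h2)
    | mul x y _ _ hx hy =>
      obtain ⟨D, hD, h1⟩ := hx
      obtain ⟨E, hE, h2⟩ := hy
      refine ⟨D * E, mul_ne_zero hD hE, ?_⟩
      have : ((D * E : ℤ) : L) * (x * y) = (D * x) * (E * y) := by
        push_cast
        ring
      rw [this]
      exact A.mul_mem h1 h2
  choose D hD hDA using hden
  classical
  set Z := (Q.map (Int.castRingHom L)).roots with hZ
  -- A common denominator of the roots.
  set e : ℤ := ∏ a ∈ Z.toFinset, D a with he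
  have he0 : e ≠ 0 := Finset.prod_ne_zero_iff.2 fun a _ => hD a
  have heA : ∀ a : L, ∃ u : A, a ∈ Z → (u : L) = e * a := by
    intro a
    by_cases ha : a ∈ Z
    · obtain ⟨c, hc⟩ : D a ∣ e := Finset.dvd_prod_of_mem D (Multiset.mem_toFinset.2 ha)
      refine ⟨⟨e * a, ?_⟩, fun _ => rfl⟩
      rw [hc, Int.cast_mul, mul_comm (D a : L), mul_assoc]
      exact A.mul_mem (A.intCast_mem c) (hDA a)
    · exact ⟨0, fun h => absurd h ha⟩
  choose U hU using heA
  obtain ⟨p, hp, hpB, n, hn⟩ := exists_prime_gt_dvd_eval (minpoly.natDegree_pos hθ)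
    (max B e.natAbs)
  have := Fact.mk hp
  have hroot : (minpoly ℤ θ).eval₂ (Int.castRingHom (ZMod p)) (n : ZMod p) = 0 := by
    rw [← eq_intCast (Int.castRingHom (ZMod p)) n, eval₂_at_apply, eq_intCast,
      ZMod.intCast_zmod_eq_zero_iff_dvd]
    exact hn
  -- The homomorphism with `θ ↦ n`, where `n` is a root of the minimal polynomial modulo `p`.
  let φ : A →+* ZMod p := (AdjoinRoot.lift (Int.castRingHom (ZMod p)) (n : ZMod p) hroot).comp
    (minpoly.equivAdjoin hθ).symm.toRingEquiv.toRingHom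
  have hφe : φ (e : A) ≠ 0 := by
    rw [map_intCast, Ne, ZMod.intCast_zmod_eq_zero_iff_dvd, Int.natCast_dvd]
    intro h
    have := Nat.le_of_dvd (Int.natAbs_pos.2 he0) h
    omega
  refine ⟨p, hp, by omega, (Z.map U).map fun u => φ u / φ (e : A), ?_, fun y => ?_⟩
  · rw [Multiset.card_map, Multiset.card_map]
    exact (card_roots' _).trans natDegree_map_le
  · refine aeval_eq_mul_prod_of_roots_lift (R := A) (L := L) Subtype.val_injective φ hL hφe ?_ y
    rw [Multiset.map_map]
    refine Multiset.map_congr rfl fun a ha => ?_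
    rw [map_intCast]
    exact hU a ha

theorem Polynomial.splits_map_splittingField (Q : ℤ[X]) :
    (Q.map (Int.castRingHom (Q.map (Int.castRingHom ℚ)).SplittingField)).Splits := by
  have h := SplittingField.splits (Q.map (Int.castRingHom ℚ))
  rwa [Polynomial.map_map, RingHom.ext_int ((algebraMap ℚ _).comp _) (Int.castRingHom _)] at h

instance Polynomial.numberField_splittingField (q : ℚ[X]) : NumberField q.SplittingField where

/-- The Galois group of a polynomial acts faithfully on its roots. -/
theorem Polynomial.finrank_splittingField_le_factorial {F : Type*} [Field F] [CharZero F]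
    (q : F[X]) :
    Module.finrank F q.SplittingField ≤ q.natDegree.factorial := by
  have : Fact ((q.map (algebraMap F q.SplittingField)).Splits) := ⟨SplittingField.splits q⟩
  have : Normal F q.SplittingField := Normal.of_isSplittingField q
  have : IsGalois F q.SplittingField := ⟨⟩
  classical
  rw [← IsGalois.card_aut_eq_finrank]
  refine (Nat.card_le_card_of_injective _ (Gal.galActionHom_injective q q.SplittingField)).trans ?_
  rw [Nat.card_perm]
  refine Nat.factorial_le ?_
  rw [Nat.card_coe_set_eq]
  exact ncard_rootSet_le q _

/-! ### Decidability of the sum -/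

namespace MeadowTerm

theorem exists_isCertificate (t : MeadowTerm) : ∃ c, IsCertificate t c := by
  obtain ⟨p, hp, hpB, s, hs, hfac⟩ := exists_prime_gt_splits _
    (splits_map_splittingField t.den) t.threshold
  have := Fact.mk hp
  obtain ⟨-, hN, hsp, h2⟩ := threshold_spec (n := 0) hpB (Nat.zero_le _)
  refine ⟨(p, (t.den.leadingCoeff : ZMod p).val, s.toList.map fun a => (-a).val), hp, hpB, ?_,
    fun x _ => ?_⟩
  · rw [List.length_map, Multiset.length_toList]
    exact (hs.trans (natDegree_num_den_le_size t).2).trans_lt hsp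
  · rw [← ZMod.natCast_eq_natCast_iff', natCast_modEval_den h2 x t le_rfl hN, hfac, Nat.cast_mul,
      ZMod.natCast_zmod_val, Nat.cast_list_prod, List.map_map, List.map_map, ← s.coe_toList,
      Multiset.map_coe, Multiset.prod_coe, s.coe_toList]
    congr 2
    refine List.map_congr_left fun a _ => ?_
    simp [sub_eq_add_neg]

/-- A term that does not vanish generically is nonzero at all but finitely many complex numbers. -/
theorem finiteSupportSum_eq_zero {t : MeadowTerm} (ht : t.num ≠ 0) :
    finiteSupportSum ℂ t = 0 := by
  refine finsum_of_infinite_support fun hfin => ?_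
  have hR : (t.num * t.den).map (Int.castRingHom ℂ) ≠ 0 :=
    (Polynomial.map_ne_zero_iff Int.cast_injective).2 (mul_ne_zero ht (den_ne_zero t))
  refine (hfin.union (finite_setOfPred_isRoot hR)).not_infinite ?_
  refine Set.infinite_univ.mono fun a _ => ?_
  by_cases ha : ((t.num * t.den).map (Int.castRingHom ℂ)).IsRoot a
  · exact Or.inr ha
  · left
    rw [IsRoot, Polynomial.eval_map] at ha
    change aeval a (t.num * t.den) ≠ 0 at ha
    rw [map_mul] at ha
    have h1 := eval_mul_den a t (right_ne_zero_of_mul ha)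
    intro h0
    rw [show t.eval a = 0 from h0, zero_mul] at h1
    exact left_ne_zero_of_mul ha h1.symm

open Classical in
theorem finiteSupportSum_eq_map_sum_roots {L : Type*} [Field L] [CharZero L] (σ : L →+* ℂ)
    {t : MeadowTerm} (ht : t.num = 0) (hL : (t.den.map (Int.castRingHom L)).Splits) :
    finiteSupportSum ℂ t =
      σ (∑ a ∈ (t.den.map (Int.castRingHom L)).roots.toFinset, t.eval a) := by
  set Z := (t.den.map (Int.castRingHom L)).roots with hZ
  have hfac := aeval_eq_mul_prod_of_roots_lift (R := L) (L := L) Function.injective_id σ hL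
    (e := 1) (by simp) (s := Z) (by simp [hZ])
  rw [map_sum, Finset.sum_congr rfl fun a _ => (eval_map σ a t).symm,
    ← Finset.sum_image (f := fun z => t.eval z) σ.injective.injOn]
  refine finsum_eq_sum_of_support_subset _ fun z hz => ?_
  have h0 : aeval z t.den = 0 := by
    by_contra hne
    have h1 := eval_mul_den z t hne
    rw [ht, map_zero] at h1
    exact hz ((mul_eq_zero.1 h1).resolve_right hne)
  rw [hfac, mul_eq_zero, or_iff_right (by
    exact_mod_cast leadingCoeff_ne_zero.2 (den_ne_zero t)), Multiset.prod_eq_zero_iff] at h0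
  simp only [map_one, div_one, Multiset.map_map, Multiset.mem_map, Function.comp] at h0
  obtain ⟨a, ha, hza⟩ := h0
  simp only [Finset.coe_image, Set.mem_image, Finset.mem_coe, Multiset.mem_toFinset]
  exact ⟨a, ha, (sub_eq_zero.1 hza).symm⟩

/-- The factorization in a certificate holds at all elements of the prime field, hence as an
identity of polynomials of degree less than `p`; so all roots of the denominator in any field of
characteristic `p` lie in the prime field. -/
theorem IsCertificate.exists_zmod_of_root {t : MeadowTerm} {c : ℕ × ℕ × List ℕ}
    (hc : IsCertificate t c) {k : Type*} [Field k] [CharP k c.1] {y : k}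
    (hy : aeval y t.den = 0) : ∃ x : ZMod c.1, ZMod.castHom dvd_rfl k x = y := by
  obtain ⟨p, e, l⟩ := c
  obtain ⟨hp, hpt, hl, hall⟩ := hc
  dsimp only at *
  have := Fact.mk hp
  obtain ⟨-, hN, hsp, h2⟩ := threshold_spec (n := 0) hpt (Nat.zero_le _)
  set ι := ZMod.castHom dvd_rfl k with hι
  have hlc : (t.den.leadingCoeff : ZMod p) ≠ 0 := by
    rw [Ne, ZMod.intCast_zmod_eq_zero_iff_dvd, Int.natCast_dvd]
    intro h
    have h1 := Nat.le_of_dvd (Int.natAbs_pos.2 (leadingCoeff_ne_zero.2 (den_ne_zero t))) h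
    have h3 : t.den.leadingCoeff.natAbs ≤ t.size :=
      (natAbs_coeff_le_length _ _).trans (length_num_den_le_size t).2
    omega
  set R := t.den.map (Int.castRingHom (ZMod p)) with hR
  set S : (ZMod p)[X] := C (e : ZMod p) * (l.map fun a : ℕ => X + C (a : ZMod p)).prod with hS
  have hS_deg : S.natDegree ≤ l.length := by
    refine (natDegree_C_mul_le _ _).trans ((natDegree_list_prod_le _).trans ?_)
    rw [List.map_map]
    refine (List.sum_le_card_nsmul _ 1 ?_).trans (by simp)
    intro i hi
    obtain ⟨a, -, rfl⟩ := List.mem_map.1 hi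
    exact (natDegree_X_add_C _).le
  have hRS : R = S := by
    rw [← sub_eq_zero]
    refine eq_zero_of_natDegree_lt_card_of_eval_eq_zero (R - S) (f := (id : ZMod p → ZMod p))
      Function.injective_id (fun x => ?_) ?_
    · have h1 := hall x.val (ZMod.val_lt x)
      rw [← ZMod.natCast_eq_natCast_iff', natCast_modEval_den h2 _ t le_rfl hN,
        ZMod.natCast_zmod_val, Nat.cast_mul, Nat.cast_list_prod, List.map_map] at h1
      rw [eval_sub, sub_eq_zero, id, hR, Polynomial.eval_map, hS, eval_mul, eval_C,
        eval_list_prod, List.map_map]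
      refine Eq.trans h1 ?_
      congr 2
      refine List.map_congr_left fun a _ => ?_
      simp
    · rw [ZMod.card]
      refine (natDegree_sub_le _ _).trans_lt (max_lt ?_ (hS_deg.trans_lt hl))
      exact natDegree_map_le.trans_lt ((natDegree_num_den_le_size t).2.trans_lt hsp)
  have hR0 : R ≠ 0 := by
    intro h0
    have := congrArg (coeff · t.den.natDegree) h0
    simp only [hR, coeff_map, coeff_zero] at this
    exact hlc this
  have he : (e : ZMod p) ≠ 0 := by
    intro h0
    rw [hRS, hS, h0, C_0, zero_mul] at hR0
    exact hR0 rfl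
  have hy' : S.eval₂ ι y = 0 := by
    rw [← hRS, hR, eval₂_map, ← hy, aeval_def,
      RingHom.ext_int (ι.comp (Int.castRingHom (ZMod p))) (algebraMap ℤ k)]
  rw [hS, eval₂_mul, eval₂_C, mul_eq_zero, or_iff_right (by
    exact (map_ne_zero ι).2 he), eval₂_list_prod, List.map_map, List.prod_eq_zero_iff] at hy'
  obtain ⟨a, -, ha⟩ := List.mem_map.1 hy'
  simp only [Function.comp, eval₂_add, eval₂_X, eval₂_C] at ha
  exact ⟨-a, by rw [map_neg]; exact (eq_neg_of_add_eq_zero_left ha).symm⟩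

theorem IsCertificate.finiteSupportSum_eq_one_iff {t : MeadowTerm} {c : ℕ × ℕ × List ℕ}
    (hc : IsCertificate t c) : finiteSupportSum ℂ t = 1 ↔ Verdict t c.1 := by
  have hk := @IsCertificate.exists_zmod_of_root t c hc
  obtain ⟨hp, hpt, -, -⟩ := hc
  set p := c.1
  have := Fact.mk hp
  obtain ⟨-, hN, hsp, h2⟩ := threshold_spec (n := 0) hpt (Nat.zero_le _)
  have h1 : (modEval p (t.size + 1) 0 t).2.1 % p = 0 ↔ t.num = 0 := by
    rw [← Nat.dvd_iff_mod_eq_zero, ← ZMod.natCast_eq_zero_iff,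
      (natCast_modEval_fst h2 (t.size + 1) 0 t).2, eval_natCast_eq_zero_iff le_rfl hN]
  have h3 : (∑ x ∈ Finset.range p, (modEval p (t.size + 1) x t).1) % p = 1 ↔
      ∑ x : ZMod p, t.eval x = 1 := by
    have e1 : ∑ x : ZMod p, t.eval x =
        ((∑ x ∈ Finset.range p, (modEval p (t.size + 1) x t).1 : ℕ) : ZMod p) := by
      rw [Nat.cast_sum]
      refine Finset.sum_nbij' ZMod.val (fun i => (i : ZMod p)) (fun x _ => Finset.mem_range.2
        (ZMod.val_lt x)) (fun _ _ => Finset.mem_univ _) (fun x _ => ZMod.natCast_zmod_val x)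
        (fun i hi => ZMod.val_cast_of_lt (Finset.mem_range.1 hi)) fun x _ => ?_
      rw [(natCast_modEval_fst h2 (t.size + 1) _ t).1, ZMod.natCast_zmod_val]
    rw [e1, ← Nat.cast_one (R := ZMod p), ZMod.natCast_eq_natCast_iff', Nat.mod_eq_of_lt hp.one_lt]
  rw [Verdict, h1, h3]
  by_cases hnum : t.num = 0
  swap
  · simp [finiteSupportSum_eq_zero hnum, hnum]
  rw [and_iff_right hnum]
  have hL := splits_map_splittingField t.den
  set q := t.den.map (Int.castRingHom ℚ) with hq
  have hfact : Module.finrank ℚ q.SplittingField ≤ q.natDegree.factorial := by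
    -- The two sides use different, but equal, `ℚ`-algebra structures.
    convert finrank_splittingField_le_factorial q
  have hfin : Module.finrank ℚ q.SplittingField ≤ t.size ^ t.size :=
    hfact.trans ((Nat.factorial_le
      (natDegree_map_le.trans (natDegree_num_den_le_size t).2)).trans (Nat.factorial_le_pow _))
  have hpmax : (Ideal.span {(p : ℤ)}).IsMaximal :=
    PrincipalIdealRing.isMaximal_of_irreducible (Nat.prime_iff_prime_int.1 hp).irreducible
  obtain ⟨P, hP, hPp⟩ := Ideal.exists_maximal_ideal_liesOver_of_isIntegral (S := 𝓞 q.SplittingField)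
    (Ideal.span {(p : ℤ)})
  let _ : Field (𝓞 q.SplittingField ⧸ P) := Ideal.Quotient.field P
  have : CharP (𝓞 q.SplittingField ⧸ P) p := by
    have hpP : ((p : ℕ) : 𝓞 q.SplittingField ⧸ P) = 0 := by
      have h1 : algebraMap ℤ (𝓞 q.SplittingField) p ∈ P := by
        rw [← Ideal.mem_comap, ← Ideal.under_def, ← hPp.over]
        exact Ideal.mem_span_singleton_self _
      have h2 := Ideal.Quotient.eq_zero_iff_mem.2 h1
      simpa using h2
    obtain ⟨r, hr⟩ := CharP.exists (𝓞 q.SplittingField ⧸ P)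
    rcases (Nat.dvd_prime hp).1 ((CharP.cast_eq_zero_iff _ r p).1 hpP) with h | h
    · exact absurd h (CharP.char_ne_one (𝓞 q.SplittingField ⧸ P) r)
    · rwa [← h]
  obtain ⟨σ⟩ : Nonempty (q.SplittingField →+* ℂ) := inferInstance
  rw [finiteSupportSum_eq_map_sum_roots σ hnum hL, ← map_one σ, σ.injective.eq_iff]
  exact sum_roots_eq_one_iff (Ideal.Quotient.mk P) hpt hfin hnum hL fun y hy => hk hy

end MeadowTerm

theorem mainTheorem4 :
    ComputablePred fun t : MeadowTerm => MeadowTerm.finiteSupportSum ℂ t = 1 :=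
  MeadowTerm.computablePred_of_certificates _ MeadowTerm.exists_isCertificate
    fun _ _ hc => hc.finiteSupportSum_eq_one_iff
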